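/- Let $\alpha>0$ and $p\in(0,1)$. Then there exists $t_{\alpha,p}>0$, depending only on $\alpha$ and $p$, such that \[ \sum_{k=1}^\infty \frac{t^k}{k!}\,\mathbf E^G_p\Bigl[\operatorname{Br}_k(K_v,v)\,E_v^k\,\mathbf 1\bigl(\alpha E_v\le \operatorname{Br}_k(K_v,v)<\infty\bigr)\Bigr]<\infty \] for every locally finite graph $G=(V,E)$ (not necessarily connected), every vertex $v\in V$ and every $0\le t<t_{\alpha,p}$. Here $\mathbf E^G_p$ is the expectation for Bernoulli-$p$ bond percolation on $G$, in which each edge of $G$ is open independently with probability $p$; $K_v$ is the cluster of $v$, i.e. the connected component of $v$ in the subgraph of open edges; and $E_v\in\{0,1,2,\dots\}\cup\{\infty\}$ is the number of edges of $G$ (open or not) that have at least one endpoint in $K_v$. For a connected graph $H$, a vertex $v$ of $H$ and a set $W$ of vertices of $H$, $\operatorname{Piv}(H,v,W)$ is the set of edges $e$ of $H$ for which there is a $w\in W$ such that $v$ is not connected to $w$ in $H$ with the edge $e$ removed, and \[ \operatorname{Br}_k(H,v)=\sup\bigl\{|\operatorname{Piv}(H,v,W)| : W\subseteq V(H),\ |W|\le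 k\bigr\}, \] which is a maximum when $H$ is finite. -/

import Mathlib

open scoped ENNReal Nat

noncomputable section

namespace BondPercolation

variable {V : Type*}

/-- The random spanning subgraph of `G` whose edges are the open edges, i.e. the edges of `G` that
belong to the configuration `ω`. -/
def openGraph (G : SimpleGraph V) (ω : Set (Sym2 V)) : SimpleGraph V :=
  G ⊓ SimpleGraph.fromEdgeSet ω

/-- The cluster `K_v(ω)`: the connected component of `v` in the open subgraph, as a subgraph of `G`
(its edges are the open edges between its vertices). -/
def cluster (G : SimpleGraph V) (ω : Set (Sym2 V)) (v : V) : G.Subgraph where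
  verts := {u | (openGraph G ω).Reachable v u}
  Adj x y := (openGraph G ω).Adj x y ∧ (openGraph G ω).Reachable v x
  adj_sub h := h.1.1
  edge_vert h := h.2
  symm := ⟨fun _ _ h => ⟨h.1.symm, h.2.trans h.1.reachable⟩⟩

/-- `E(H)`: the set of edges of `G` that touch `H`, i.e. that have at least one endpoint in the
vertex set of `H`. These are not only the edges of `H`. -/
def touchingEdges {G : SimpleGraph V} (H : G.Subgraph) : Set (Sym2 V) :=
  {e | e ∈ G.edgeSet ∧ ∃ x ∈ H.verts, x ∈ e}

/-- `E_v(ω) = |E(K_v(ω))|`, equal to `∞` when infinitely many edges touch the cluster. -/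
def numTouching (G : SimpleGraph V) (ω : Set (Sym2 V)) (v : V) : ℕ∞ :=
  (touchingEdges (cluster G ω v)).encard

/-- `Piv(H, v, W)`: the edges `e` of `H` such that `v` is not connected to some `w ∈ W` in `H`
with `e` removed. -/
def piv {G : SimpleGraph V} (H : G.Subgraph) (v : V) (W : Set V) : Set (Sym2 V) :=
  {e | e ∈ H.edgeSet ∧ ∃ w ∈ W, ¬ (H.deleteEdges {e}).spanningCoe.Reachable v w}

/-- `Br_k(H, v)`: the maximum of `|Piv(H, v, W)|` over the sets `W` of at most `k` vertices of `H`.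
For finite `H` the supremum is over finitely many natural numbers, hence is a maximum. -/
def br {G : SimpleGraph V} (k : ℕ) (H : G.Subgraph) (v : V) : ℕ∞ :=
  ⨆ (W : Finset V) (_ : (W : Set V) ⊆ H.verts ∧ W.card ≤ k), (piv H v (W : Set V)).encard

/-- The law of Bernoulli-`p` bond percolation on `G`: the random set of open edges contains each
edge of `G` independently with probability `p`. -/
abbrev bernoulliLaw (G : SimpleGraph V) (p : unitInterval) : MeasureTheory.Measure (Set (Sym2 V)) :=
  ProbabilityTheory.setBernoulli G.edgeSet p

end BondPercolation

end

/-! Everything reduces to a finite edge set `F`. A cluster with open edge set `A` and `E` touching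
edges has probability p^|A| (1-p)^(E-|A|), and a bound uniform in `F` passes to any locally finite
graph. Cutting at a bridge factorises this probability (`weight_split`) into a near cluster, a
factor p/(1-p), and an independent far cluster in the edges that do not touch the near one.

Fix a small x, put l = 4x²/(p(1-p))² and u = e^(-l), and damp every cluster by u^E. This amounts to
colouring touching edges green with probability 1-u. The core estimate `sum_boundary_escape_le` says
that the mean number of bridges with green only on their far side is at most p/x times the
probability of meeting green. Bridges and boundary edges can be traded for the fluctuation
closed/(1-p) - open/p of the whole cluster. This fluctuation is the first-order term of the
likelihood ratio between p-x and p, the total mass at p-x is at most 1, and the damping l absorbs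
the quadratic error.

With b = 1 + x/2, induction on |F| (`pathSum_le`) bounds the damped mean of the sum over w of
b^|Piv(v,w)|. Adding the vertices of W one by one, `branchSum_le` gets (cn)^j/j! for sets of j
vertices in clusters with at most n touching edges. So the generating function of z^|W| b^|Piv(W)|
has mean at most exp((l + zc)n) on E = n.

If Br_k ≥ αE, some W with |W| ≤ k has b^|Piv(W)| ≥ exp(α n log b). The cost l is quadratic in x and
the gain α log b is linear, so a small x, and then a small z, leaves exponential decay in n. For t ≤
τz the power z^k pays for W, and the remaining series in (τE)^k/k! costs only e^(τE). -/

namespace BondPercolation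

/-! ### Finite clusters, bridges, and cutting a cluster at a bridge -/

noncomputable section FiniteClusters

open scoped Classical

variable {V : Type*}

/-- `x` and `y` are joined by a path of edges in the finite edge set `A`. -/
def Conn (A : Finset (Sym2 V)) (x y : V) : Prop :=
  Relation.ReflTransGen (fun a b => s(a, b) ∈ A) x y

theorem Conn.refl (A : Finset (Sym2 V)) (x : V) : Conn A x x := Relation.ReflTransGen.refl

theorem Conn.trans {A : Finset (Sym2 V)} {x y z : V} (h : Conn A x y) (h' : Conn A y z) :
    Conn A x z := Relation.ReflTransGen.trans h h'

theorem Conn.tail {A : Finset (Sym2 V)} {x y z : V} (h : Conn A x y) (h' : s(y, z) ∈ A) :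
    Conn A x z := Relation.ReflTransGen.tail h h'

theorem Conn.mono {A B : Finset (Sym2 V)} (hAB : A ⊆ B) {x y : V} (h : Conn A x y) :
    Conn B x y := by
  induction h with
  | refl => exact Conn.refl _ _
  | tail _ hbc ih => exact ih.tail (hAB hbc)

theorem Conn.of_mem {A : Finset (Sym2 V)} {e : Sym2 V} (he : e ∈ A) {v x y : V} (hx : x ∈ e)
    (hy : y ∈ e) (h : Conn A v x) : Conn A v y := by
  induction e using Sym2.inductionOn with
  | _ a b =>
    rw [Sym2.mem_iff] at hx hy
    rcases hx with rfl | rfl <;> rcases hy with rfl | rfl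
    · exact h
    · exact h.tail he
    · exact h.tail (by rwa [Sym2.eq_swap])
    · exact h

/-- An induction principle: a set of vertices containing `v` and closed under crossing the edges of
`A` contains everything connected to `v`. -/
theorem Conn.induct {A : Finset (Sym2 V)} {v w : V} (h : Conn A v w) {P : V → Prop} (h0 : P v)
    (hs : ∀ x y, s(x, y) ∈ A → Conn A v x → P x → P y) : P w := by
  induction h with
  | refl => exact h0
  | tail hab hbc ih => exact hs _ _ hbc hab ih

/-- The edges of `F` with an endpoint in the cluster of `v` in `A`. -/
def touch (F A : Finset (Sym2 V)) (v : V) : Finset (Sym2 V) :=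
  F.filter fun e => ∃ x ∈ e, Conn A v x

theorem mem_touch {F A : Finset (Sym2 V)} {v : V} {e : Sym2 V} :
    e ∈ touch F A v ↔ e ∈ F ∧ ∃ x ∈ e, Conn A v x := by simp [touch]

theorem touch_subset (F A : Finset (Sym2 V)) (v : V) : touch F A v ⊆ F := Finset.filter_subset _ _

theorem touch_congr {F A B : Finset (Sym2 V)} {v : V} (h : ∀ x, Conn A v x ↔ Conn B v x) :
    touch F A v = touch F B v := by
  ext e; simp [mem_touch, h]

/-- The possible edge sets of the open cluster of `v` in a percolation configuration on `F`. -/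
def clusters (F : Finset (Sym2 V)) (v : V) : Finset (Finset (Sym2 V)) :=
  F.powerset.filter fun A => A ⊆ touch F A v

theorem mem_clusters {F A : Finset (Sym2 V)} {v : V} :
    A ∈ clusters F v ↔ A ⊆ touch F A v := by
  simp only [clusters, Finset.mem_filter, Finset.mem_powerset, and_iff_right_iff_imp]
  exact fun h => h.trans (touch_subset _ _ _)

/-- The edges of `A` whose removal disconnects `w` from `v`. -/
def pivotal (A : Finset (Sym2 V)) (v w : V) : Finset (Sym2 V) :=
  A.filter fun e => ¬ Conn (A.erase e) v w

theorem mem_pivotal {A : Finset (Sym2 V)} {v w : V} {e : Sym2 V} :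
    e ∈ pivotal A v w ↔ e ∈ A ∧ ¬ Conn (A.erase e) v w := by simp [pivotal]

/-- The edges of `A` whose removal disconnects one of their own endpoints from `v`. -/
def bridges (A : Finset (Sym2 V)) (v : V) : Finset (Sym2 V) :=
  A.filter fun e => ∃ z ∈ e, ¬ Conn (A.erase e) v z

theorem mem_bridges {A : Finset (Sym2 V)} {v : V} {e : Sym2 V} :
    e ∈ bridges A v ↔ e ∈ A ∧ ∃ z ∈ e, ¬ Conn (A.erase e) v z := by simp [bridges]

/-- The edges of `F` with exactly one endpoint in the cluster of `v` in `A`. -/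
def boundary (F A : Finset (Sym2 V)) (v : V) : Finset (Sym2 V) :=
  (touch F A v).filter fun e => ∃ z ∈ e, ¬ Conn A v z

theorem mem_boundary {F A : Finset (Sym2 V)} {v : V} {e : Sym2 V} :
    e ∈ boundary F A v ↔ e ∈ touch F A v ∧ ∃ z ∈ e, ¬ Conn A v z := by simp [boundary]

/-- An endpoint of `e` which is not in the cluster of `v` in `A`, if there is one. -/
def outer (A : Finset (Sym2 V)) (v : V) (e : Sym2 V) : V :=
  if h : ∃ z ∈ e, ¬ Conn A v z then h.choose else v

theorem outer_spec {A : Finset (Sym2 V)} {v : V} {e : Sym2 V} (h : ∃ z ∈ e, ¬ Conn A v z) :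
    outer A v e ∈ e ∧ ¬ Conn A v (outer A v e) := by
  rw [outer, dif_pos h]; exact h.choose_spec

/-- The part of `A` that stays attached to `v` when `f` is removed. -/
def nearPart (A : Finset (Sym2 V)) (v : V) (f : Sym2 V) : Finset (Sym2 V) :=
  touch (A.erase f) (A.erase f) v

/-- The part of `A` that is detached from `v` when `f` is removed. -/
def farPart (A : Finset (Sym2 V)) (v : V) (f : Sym2 V) : Finset (Sym2 V) :=
  A.erase f \ nearPart A v f

theorem conn_nearPart {A : Finset (Sym2 V)} {v x : V} {f : Sym2 V} :
    Conn (nearPart A v f) v x ↔ Conn (A.erase f) v x := by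
  refine ⟨Conn.mono (touch_subset _ _ _), fun h => ?_⟩
  refine h.induct (P := fun x => Conn (nearPart A v f) v x) (Conn.refl _ _) ?_
  intro x y hxy hvx hx
  exact hx.tail (mem_touch.2 ⟨hxy, x, by simp, hvx⟩)

/-- The endpoint of the bridge `f` on the far side of `v`. -/
def farEnd (A : Finset (Sym2 V)) (v : V) (f : Sym2 V) : V := outer (nearPart A v f) v f

theorem Conn.erase_or {A : Finset (Sym2 V)} {v x : V} (f : Sym2 V) (h : Conn A v x) :
    Conn (A.erase f) v x ∨ ∃ z ∈ f, Conn (A.erase f) v z := by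
  refine h.induct (P := fun x => Conn (A.erase f) v x ∨ ∃ z ∈ f, Conn (A.erase f) v z)
    (Or.inl (Conn.refl _ _)) ?_
  rintro x y hxy - (hx | hx)
  · by_cases hf : s(x, y) = f
    · exact Or.inr ⟨x, by simp [← hf], hx⟩
    · exact Or.inl (hx.tail (Finset.mem_erase.2 ⟨hf, hxy⟩))
  · exact Or.inr hx

/-- If both endpoints of `f` were still reachable without `f`, every path through `f` could be
rerouted, and `w` would remain reachable. -/
theorem pivotal_subset_bridges {A : Finset (Sym2 V)} {v w : V} (hw : Conn A v w) :
    pivotal A v w ⊆ bridges A v := by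
  intro f hf
  obtain ⟨hfA, hf⟩ := mem_pivotal.1 hf
  refine mem_bridges.2 ⟨hfA, ?_⟩
  by_contra! hcon
  refine hf (hw.induct (P := fun x => Conn (A.erase f) v x) (Conn.refl _ _) ?_)
  intro x y hxy _ hx
  by_cases hxf : s(x, y) = f
  · exact hcon y (by simp [← hxf])
  · exact hx.tail (Finset.mem_erase.2 ⟨hxf, hxy⟩)

section Bridge

variable {F A : Finset (Sym2 V)} {v : V} {f : Sym2 V}

theorem farEnd_spec (hf : f ∈ bridges A v) :
    farEnd A v f ∈ f ∧ ¬ Conn (nearPart A v f) v (farEnd A v f) := by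
  obtain ⟨z, hz, hvz⟩ := (mem_bridges.1 hf).2
  exact outer_spec ⟨z, hz, fun h => hvz (conn_nearPart.1 h)⟩

theorem exists_nearEnd (hA : A ∈ clusters F v) (hf : f ∈ bridges A v) :
    ∃ a, f = s(a, farEnd A v f) ∧ Conn (nearPart A v f) v a := by
  have hfA := (mem_bridges.1 hf).1
  obtain ⟨-, x, hx, hvx⟩ := mem_touch.1 (mem_clusters.1 hA hfA)
  have h1 : ∃ z ∈ f, Conn (A.erase f) v z := by
    rcases hvx.erase_or f with h | h
    · exact ⟨x, hx, h⟩
    · exact h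
  obtain ⟨a, haf, hva⟩ := h1
  obtain ⟨hb, hvb⟩ := farEnd_spec hf
  have hva' := conn_nearPart.2 hva
  refine ⟨a, ?_, hva'⟩
  refine (Sym2.mem_and_mem_iff ?_).1 ⟨haf, hb⟩
  rintro h
  rw [← h] at hvb
  exact hvb hva'

theorem nearPart_subset : nearPart A v f ⊆ A.erase f := touch_subset _ _ _

theorem farPart_subset : farPart A v f ⊆ A.erase f := Finset.sdiff_subset

theorem farPart_not_touch {e : Sym2 V} (he : e ∈ farPart A v f) {x : V} (hx : x ∈ e) :
    ¬ Conn (nearPart A v f) v x := by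
  rw [farPart, Finset.mem_sdiff] at he
  exact fun h => he.2 (mem_touch.2 ⟨he.1, x, hx, conn_nearPart.1 h⟩)

theorem nearPart_mem_clusters (hA : A ∈ clusters F v) : nearPart A v f ∈ clusters F v := by
  rw [mem_clusters]
  intro e he
  obtain ⟨heA, x, hx, hvx⟩ := mem_touch.1 he
  exact mem_touch.2 ⟨touch_subset _ _ _ (mem_clusters.1 hA (Finset.mem_of_mem_erase heA)), x, hx,
    conn_nearPart.2 hvx⟩

theorem mem_boundary_nearPart (hA : A ∈ clusters F v) (hf : f ∈ bridges A v) :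
    f ∈ boundary F (nearPart A v f) v := by
  obtain ⟨a, ha, hva⟩ := exists_nearEnd hA hf
  obtain ⟨hb, hvb⟩ := farEnd_spec hf
  have hfF := touch_subset _ _ _ (mem_clusters.1 hA (mem_bridges.1 hf).1)
  refine mem_boundary.2 ⟨mem_touch.2 ⟨hfF, a, ?_, hva⟩, _, hb, hvb⟩
  rw [ha]; simp

theorem conn_iff_near_or_far (hA : A ∈ clusters F v) (hf : f ∈ bridges A v) (x : V) :
    Conn A v x ↔ Conn (nearPart A v f) v x ∨ Conn (farPart A v f) (farEnd A v f) x := by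
  obtain ⟨a, ha, hva⟩ := exists_nearEnd hA hf
  have hnA : nearPart A v f ⊆ A := nearPart_subset.trans (Finset.erase_subset _ _)
  have hfA : farPart A v f ⊆ A := farPart_subset.trans (Finset.erase_subset _ _)
  constructor
  · intro h
    refine h.induct (P := fun x => Conn (nearPart A v f) v x ∨
      Conn (farPart A v f) (farEnd A v f) x) (Or.inl (Conn.refl _ _)) ?_
    intro x y hxy _ hx
    by_cases hxf : s(x, y) = f
    · have hy : y ∈ f := by simp [← hxf]
      rw [ha, Sym2.mem_iff] at hy
      rcases hy with rfl | rfl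
      · exact Or.inl hva
      · exact Or.inr (Conn.refl _ _)
    · have hxA : s(x, y) ∈ A.erase f := Finset.mem_erase.2 ⟨hxf, hxy⟩
      by_cases hn : s(x, y) ∈ nearPart A v f
      · obtain ⟨-, z, hz, hvz⟩ := mem_touch.1 hn
        exact Or.inl ((conn_nearPart.2 hvz).of_mem hn hz (by simp))
      · have hfar : s(x, y) ∈ farPart A v f := Finset.mem_sdiff.2 ⟨hxA, hn⟩
        rcases hx with hx | hx
        · exact absurd hx (farPart_not_touch hfar (by simp))
        · exact Or.inr (hx.tail hfar)
  · rintro (h | h)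
    · exact h.mono hnA
    · refine Conn.trans ?_ (h.mono hfA)
      refine (hva.mono hnA).tail ?_
      rw [← ha]; exact (mem_bridges.1 hf).1

theorem farPart_mem_clusters (hA : A ∈ clusters F v) (hf : f ∈ bridges A v) :
    farPart A v f ∈ clusters (F \ touch F (nearPart A v f) v) (farEnd A v f) := by
  rw [mem_clusters]
  intro e he
  have heA : e ∈ A := Finset.mem_of_mem_erase (farPart_subset he)
  obtain ⟨heF, x, hx, hvx⟩ := mem_touch.1 (mem_clusters.1 hA heA)
  refine mem_touch.2 ⟨Finset.mem_sdiff.2 ⟨heF, fun h => ?_⟩, x, hx, ?_⟩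
  · obtain ⟨-, z, hz, hvz⟩ := mem_touch.1 h
    exact farPart_not_touch he hz hvz
  · exact ((conn_iff_near_or_far hA hf x).1 hvx).resolve_left (farPart_not_touch he hx)

/-- An edge touching both parts is charged to the near part. This is why the far part lives in `F \
touch F (nearPart A v f) v`, and it makes powers of the touching number multiplicative under
cutting. -/
theorem card_touch_split (hA : A ∈ clusters F v) (hf : f ∈ bridges A v) :
    (touch F A v).card = (touch F (nearPart A v f) v).card +
      (touch (F \ touch F (nearPart A v f) v) (farPart A v f) (farEnd A v f)).card := by
  rw [← Finset.card_union_of_disjoint]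
  · congr 1
    ext e
    simp only [Finset.mem_union, mem_touch, Finset.mem_sdiff, conn_iff_near_or_far hA hf]
    constructor
    · rintro ⟨heF, x, hx, h | h⟩
      · exact Or.inl ⟨heF, x, hx, h⟩
      · by_cases hc : ∃ x ∈ e, Conn (nearPart A v f) v x
        · exact Or.inl ⟨heF, hc⟩
        · exact Or.inr ⟨⟨heF, fun h' => hc h'.2⟩, x, hx, h⟩
    · rintro (⟨heF, x, hx, h⟩ | ⟨⟨heF, -⟩, x, hx, h⟩)
      · exact ⟨heF, x, hx, Or.inl h⟩
      · exact ⟨heF, x, hx, Or.inr h⟩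
  · rw [Finset.disjoint_left]
    intro e he he'
    exact (Finset.mem_sdiff.1 (touch_subset _ _ _ he')).2 he

theorem card_split (hf : f ∈ bridges A v) :
    A.card = (nearPart A v f).card + (farPart A v f).card + 1 := by
  have h1 : (nearPart A v f).card + (farPart A v f).card = (A.erase f).card := by
    rw [farPart, add_comm]
    exact Finset.card_sdiff_add_card_eq_card nearPart_subset
  rw [h1, Finset.card_erase_add_one (mem_bridges.1 hf).1]

/-- The inequality is strict because the removed bridge touches the near part without belonging to
it. -/
theorem card_nearPart_lt (hA : A ∈ clusters F v) (hf : f ∈ bridges A v) :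
    (nearPart A v f).card < (touch F (nearPart A v f) v).card := by
  refine Finset.card_lt_card ⟨mem_clusters.1 (nearPart_mem_clusters hA), fun h => ?_⟩
  have := h (mem_boundary.1 (mem_boundary_nearPart hA hf)).1
  exact Finset.notMem_erase f A (nearPart_subset this)

theorem eq_of_split (hf : f ∈ bridges A v) :
    A = insert f (nearPart A v f ∪ farPart A v f) := by
  rw [farPart, Finset.union_sdiff_of_subset nearPart_subset,
    Finset.insert_erase (mem_bridges.1 hf).1]

/-- The edges separating `v` from `w` are linearly ordered by the size of their near parts. -/
theorem card_nearPart_lt_or_mem_pivotal (hA : A ∈ clusters F v) {w : V} (hw : Conn A v w)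
    {g h : Sym2 V} (hg : g ∈ pivotal A v w) (hh : h ∈ pivotal A v w) (hgh : h ≠ g) :
    (nearPart A v h).card < (nearPart A v g).card ∨
      h ∈ pivotal (farPart A v g) (farEnd A v g) w := by
  have hgb := pivotal_subset_bridges hw hg
  obtain ⟨hgA, hgw⟩ := mem_pivotal.1 hg
  obtain ⟨hhA, hhw⟩ := mem_pivotal.1 hh
  obtain ⟨a, ha, hva⟩ := exists_nearEnd hA hgb
  have hfarw : Conn (farPart A v g) (farEnd A v g) w :=
    ((conn_iff_near_or_far hA hgb w).1 hw).resolve_left fun h => hgw (conn_nearPart.1 h)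
  have hgA' : g ∈ A.erase h := Finset.mem_erase.2 ⟨hgh.symm, hgA⟩
  by_cases hn : h ∈ nearPart A v g
  · left
    have hhfar : h ∉ farPart A v g := fun h' => (Finset.mem_sdiff.1 h').2 hn
    have hfarw' : Conn (A.erase h) (farEnd A v g) w := hfarw.mono
      (Finset.subset_erase.2 ⟨farPart_subset.trans (Finset.erase_subset _ _), hhfar⟩)
    have hfe : ¬ Conn (A.erase h) v (farEnd A v g) := fun h' => hhw (h'.trans hfarw')
    -- A path from `v` avoiding `h` cannot use `g`: it would reach the far end of `g` and from there
    -- `w`, still avoiding `h`. Hence the near part of `h` is strictly inside that of `g`.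
    have key : ∀ x, Conn (A.erase h) v x → Conn (A.erase g) v x := by
      intro x hx
      refine hx.induct (P := fun x => Conn (A.erase g) v x) (Conn.refl _ _) ?_
      intro x y hxy hvx hx
      have : s(x, y) ≠ g := fun h' =>
        hfe (hvx.of_mem hxy (x := x) (by simp) (by rw [h']; exact (farEnd_spec hgb).1))
      exact hx.tail (Finset.mem_erase.2 ⟨this, Finset.mem_of_mem_erase hxy⟩)
    refine Finset.card_lt_card ⟨fun e he => ?_, fun hsub => ?_⟩
    · obtain ⟨he, x, hx, hvx⟩ := mem_touch.1 he
      have : e ≠ g := fun h' =>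
        hfe (hvx.of_mem he hx (by rw [h']; exact (farEnd_spec hgb).1))
      exact mem_touch.2 ⟨Finset.mem_erase.2 ⟨this, Finset.mem_of_mem_erase he⟩, x, hx, key x hvx⟩
    · exact Finset.notMem_erase h A (nearPart_subset (hsub hn))
  · right
    refine mem_pivotal.2 ⟨Finset.mem_sdiff.2 ⟨Finset.mem_erase.2 ⟨hgh, hhA⟩, hn⟩, fun hc => hhw ?_⟩
    refine Conn.trans ?_ (hc.mono fun e he => Finset.mem_erase.2
      ⟨Finset.ne_of_mem_erase he,
        Finset.mem_of_mem_erase (farPart_subset (Finset.mem_of_mem_erase he))⟩)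
    refine (hva.mono (Finset.subset_erase.2
      ⟨nearPart_subset.trans (Finset.erase_subset _ _), hn⟩)).tail ?_
    rw [← ha]; exact hgA'

end Bridge

end FiniteClusters

end BondPercolation

namespace BondPercolation

/-! ### Cluster probabilities and two injective edge surgeries -/

noncomputable section ClusterSums

open scoped Classical

variable {V : Type*}

theorem sum_le_sum_of_injOn_map {α β : Type*} {s : Finset α} {t : Finset β} {f : α → ℝ} {g : β → ℝ}
    (i : α → β) (hi : ∀ a ∈ s, i a ∈ t) (hinj : Set.InjOn i s) (hle : ∀ a ∈ s, f a ≤ g (i a))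
    (h0 : ∀ b ∈ t, 0 ≤ g b) : ∑ a ∈ s, f a ≤ ∑ b ∈ t, g b :=
  calc ∑ a ∈ s, f a ≤ ∑ a ∈ s, g (i a) := Finset.sum_le_sum hle
    _ = ∑ b ∈ s.image i, g b := (Finset.sum_image hinj).symm
    _ ≤ ∑ b ∈ t, g b := Finset.sum_le_sum_of_subset_of_nonneg
        (Finset.image_subset_iff.2 hi) fun b hb _ => h0 b hb

/-- The probability that the open edges among those touching the cluster of `v` in `A` are exactly
the edges of `A`. -/
def weight (p : ℝ) (F A : Finset (Sym2 V)) (v : V) : ℝ :=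
  p ^ A.card * (1 - p) ^ ((touch F A v).card - A.card)

theorem weight_nonneg {p : ℝ} (h0 : 0 ≤ p) (h1 : p ≤ 1) (F A : Finset (Sym2 V)) (v : V) :
    0 ≤ weight p F A v :=
  mul_nonneg (pow_nonneg h0 _) (pow_nonneg (sub_nonneg.2 h1) _)

theorem conn_union_iff {F A B : Finset (Sym2 V)} {v x : V} (hB : B ⊆ F \ touch F A v) :
    Conn (A ∪ B) v x ↔ Conn A v x := by
  refine ⟨fun h => ?_, Conn.mono Finset.subset_union_left⟩
  refine h.induct (P := fun x => Conn A v x) (Conn.refl _ _) ?_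
  intro x y hxy _ hx
  rcases Finset.mem_union.1 hxy with h | h
  · exact hx.tail h
  · have := Finset.mem_sdiff.1 (hB h)
    exact absurd (mem_touch.2 ⟨this.1, x, by simp, hx⟩) this.2

/-- Each weight is the total probability of the configurations A ∪ B with `B` among the edges not
touching the cluster. The pair (A, B) is recovered from A ∪ B as its touching and non-touching
edges, so these configurations are distinct. -/
theorem sum_weight_le_one {p : ℝ} (h0 : 0 ≤ p) (h1 : p ≤ 1) (F : Finset (Sym2 V)) (v : V) :
    ∑ A ∈ clusters F v, weight p F A v ≤ 1 := by
  have hq : 0 ≤ 1 - p := sub_nonneg.2 h1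
  have hfib : ∀ A ∈ clusters F v, weight p F A v =
      ∑ B ∈ (F \ touch F A v).powerset, p ^ (A ∪ B).card * (1 - p) ^ (F.card - (A ∪ B).card) := by
    intro A hA
    have hAt := mem_clusters.1 hA
    have hsum := Finset.sum_pow_mul_eq_add_pow p (1 - p) (F \ touch F A v)
    rw [add_sub_cancel, one_pow] at hsum
    refine (mul_one (weight p F A v)).symm.trans ?_
    refine (congrArg (weight p F A v * ·) hsum.symm).trans ?_
    simp only [Finset.mul_sum]
    refine Finset.sum_congr rfl fun B hB => ?_
    rw [Finset.mem_powerset] at hB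
    have hdisj : Disjoint A B := by
      rw [Finset.disjoint_left]
      exact fun e he he' => (Finset.mem_sdiff.1 (hB he')).2 (hAt he)
    rw [Finset.card_union_of_disjoint hdisj, weight]
    have c1 := Finset.card_le_card hAt
    have c2 := Finset.card_le_card hB
    have c3 := Finset.card_sdiff_add_card_eq_card (touch_subset F A v)
    rw [show F.card - (A.card + B.card) =
      ((touch F A v).card - A.card) + ((F \ touch F A v).card - B.card) by omega]
    rw [pow_add, pow_add]; ring
  rw [Finset.sum_congr rfl hfib, Finset.sum_sigma']
  have htot := Finset.sum_pow_mul_eq_add_pow p (1 - p) F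
  rw [add_sub_cancel, one_pow] at htot
  refine (sum_le_sum_of_injOn_map
    (g := fun ω : Finset (Sym2 V) => p ^ ω.card * (1 - p) ^ (F.card - ω.card))
    (fun x : (Σ _ : Finset (Sym2 V), Finset (Sym2 V)) => x.1 ∪ x.2) ?_ ?_ (fun _ _ => le_rfl)
    ?_).trans_eq htot
  · rintro ⟨A, B⟩ h
    obtain ⟨hA, hB⟩ := Finset.mem_sigma.1 h
    rw [Finset.mem_powerset] at hB ⊢
    exact Finset.union_subset ((mem_clusters.1 hA).trans (touch_subset _ _ _))
      (hB.trans Finset.sdiff_subset)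
  · have recover : ∀ A B : Finset (Sym2 V), A ∈ clusters F v → B ⊆ F \ touch F A v →
        A = (A ∪ B) ∩ touch F (A ∪ B) v ∧ B = (A ∪ B) \ touch F (A ∪ B) v := by
      intro A B hA hB
      rw [touch_congr fun x => conn_union_iff hB]
      have hAt := mem_clusters.1 hA
      constructor
      · ext e
        have := @hAt e
        have := @hB e
        simp only [Finset.mem_inter, Finset.mem_union, Finset.mem_sdiff] at *
        tauto
      · ext e
        have := @hAt e
        have := @hB e
        simp only [Finset.mem_union, Finset.mem_sdiff] at *
        tauto
    rintro ⟨A, B⟩ h ⟨A', B'⟩ h' heq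
    obtain ⟨hA, hB⟩ := Finset.mem_sigma.1 (Finset.mem_coe.1 h)
    obtain ⟨hA', hB'⟩ := Finset.mem_sigma.1 (Finset.mem_coe.1 h')
    obtain ⟨r1, r2⟩ := recover A B hA (Finset.mem_powerset.1 hB)
    obtain ⟨r1', r2'⟩ := recover A' B' hA' (Finset.mem_powerset.1 hB')
    have heq' : A ∪ B = A' ∪ B' := heq
    rw [← heq'] at r1' r2'
    rw [r1.trans r1'.symm, r2.trans r2'.symm]
  · exact fun b _ => mul_nonneg (pow_nonneg h0 _) (pow_nonneg hq _)

/-- For the near part alone, `f` is a closed touching edge. Opening it replaces a factor 1 - p by p,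
and the remaining touching edges are those of the far part. -/
theorem weight_split {p : ℝ} (h1 : p < 1) {F A : Finset (Sym2 V)} {v : V}
    {f : Sym2 V} (hA : A ∈ clusters F v) (hf : f ∈ bridges A v) :
    weight p F A v = weight p F (nearPart A v f) v * (p / (1 - p)) *
      weight p (F \ touch F (nearPart A v f) v) (farPart A v f) (farEnd A v f) := by
  have hq : 1 - p ≠ 0 := (sub_pos.2 h1).ne'
  have c1 := card_touch_split hA hf
  have c2 := card_split hf
  have c3 := card_nearPart_lt hA hf
  have c4 := Finset.card_le_card (mem_clusters.1 (farPart_mem_clusters hA hf))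
  obtain ⟨m, hm⟩ : ∃ m, (touch F (nearPart A v f) v).card = (nearPart A v f).card + m + 1 :=
    Nat.exists_eq_add_of_lt c3
  simp only [weight]
  rw [c1, c2, hm]
  rw [show (nearPart A v f).card + m + 1 - (nearPart A v f).card = m + 1 by omega,
    show (nearPart A v f).card + m + 1 + (touch (F \ touch F (nearPart A v f) v) (farPart A v f)
      (farEnd A v f)).card - ((nearPart A v f).card + (farPart A v f).card + 1) =
      m + ((touch (F \ touch F (nearPart A v f) v) (farPart A v f)
      (farEnd A v f)).card - (farPart A v f).card) by omega]
  rw [pow_add, pow_add, pow_add, pow_succ (1 - p) m]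
  field_simp

/-- Cutting a cluster at a bridge. -/
theorem sum_bridges_le {p : ℝ} (h0 : 0 < p) (h1 : p < 1) (F : Finset (Sym2 V)) (v : V)
    (Φ : Finset (Sym2 V) → Sym2 V → ℝ) (Ψ : Finset (Sym2 V) → Sym2 V → Finset (Sym2 V) → ℝ)
    (hΦ : ∀ A ∈ clusters F v, ∀ f ∈ bridges A v, Φ A f ≤ Ψ (nearPart A v f) f (farPart A v f))
    (hΨ : ∀ A f B, 0 ≤ Ψ A f B) :
    ∑ A ∈ clusters F v, ∑ f ∈ bridges A v, weight p F A v * Φ A f ≤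
      ∑ A ∈ clusters F v, ∑ f ∈ boundary F A v,
        ∑ B ∈ clusters (F \ touch F A v) (outer A v f),
          weight p F A v * (p / (1 - p)) * weight p (F \ touch F A v) B (outer A v f) *
            Ψ A f B := by
  have hr : 0 ≤ p / (1 - p) := div_nonneg h0.le (sub_nonneg.2 h1.le)
  simp_rw [Finset.sum_sigma']
  refine sum_le_sum_of_injOn_map
    (fun x : (Σ _ : Finset (Sym2 V), Sym2 V) =>
      (⟨nearPart x.1 v x.2, x.2, farPart x.1 v x.2⟩ :
        Σ _ : Finset (Sym2 V), Σ _ : Sym2 V, Finset (Sym2 V))) ?_ ?_ ?_ ?_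
  · rintro ⟨A, f⟩ h
    obtain ⟨hA, hf⟩ := Finset.mem_sigma.1 h
    simp only [Finset.mem_sigma]
    exact ⟨nearPart_mem_clusters hA, mem_boundary_nearPart hA hf, farPart_mem_clusters hA hf⟩
  · rintro ⟨A, f⟩ h ⟨A', f'⟩ h' heq
    obtain ⟨hA, hf⟩ := Finset.mem_sigma.1 (Finset.mem_coe.1 h)
    obtain ⟨hA', hf'⟩ := Finset.mem_sigma.1 (Finset.mem_coe.1 h')
    simp only [Sigma.mk.injEq, heq_eq_eq] at heq hf hf'
    have e1 := eq_of_split hf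
    have e2 := eq_of_split hf'
    rw [heq.1, heq.2.2, heq.2.1, ← e2] at e1
    simp only [Sigma.mk.injEq, heq_eq_eq]
    exact ⟨e1, heq.2.1⟩
  · rintro ⟨A, f⟩ h
    obtain ⟨hA, hf⟩ := Finset.mem_sigma.1 h
    simp only at hA hf ⊢
    rw [weight_split h1 hA hf]
    refine mul_le_mul_of_nonneg_left (hΦ A hA f hf) ?_
    exact mul_nonneg (mul_nonneg (weight_nonneg h0.le h1.le _ _ _) hr)
      (weight_nonneg h0.le h1.le _ _ _)
  · rintro ⟨A, f, B⟩ _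
    exact mul_nonneg (mul_nonneg (mul_nonneg (weight_nonneg h0.le h1.le _ _ _) hr)
      (weight_nonneg h0.le h1.le _ _ _)) (hΨ _ _ _)

theorem conn_erase_iff {A : Finset (Sym2 V)} {v x : V} {e : Sym2 V} (heA : e ∈ A)
    (he : e ∉ bridges A v) : Conn (A.erase e) v x ↔ Conn A v x := by
  refine ⟨Conn.mono (Finset.erase_subset _ _), fun h => ?_⟩
  by_contra hc
  exact he (pivotal_subset_bridges h (mem_pivotal.2 ⟨heA, hc⟩))

/-- Closing an open edge of a cluster which is not a bridge. -/
theorem sum_nonbridges_le {p : ℝ} (h0 : 0 < p) (h1 : p < 1) (F : Finset (Sym2 V)) (v : V)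
    (θ : ℕ → ℝ) (hθ : ∀ n, 0 ≤ θ n) :
    ∑ A ∈ clusters F v, weight p F A v * θ (touch F A v).card *
        (((A \ bridges A v).card : ℝ) / p) ≤
      ∑ A ∈ clusters F v, weight p F A v * θ (touch F A v).card *
        ((((touch F A v \ A) \ boundary F A v).card : ℝ) / (1 - p)) := by
  have hq : 0 < 1 - p := sub_pos.2 h1
  have hconst : ∀ (s : Finset (Sym2 V)) (a b : ℝ), a * ((s.card : ℝ) / b) = ∑ _e ∈ s, a / b := by
    intro s a b; simp; ring
  simp_rw [hconst, Finset.sum_sigma']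
  have hsame : ∀ A e, e ∈ A \ bridges A v →
      touch F (A.erase e) v = touch F A v := fun A e he =>
    touch_congr fun x => conn_erase_iff (Finset.mem_sdiff.1 he).1 (Finset.mem_sdiff.1 he).2
  refine sum_le_sum_of_injOn_map
    (fun x : (Σ _ : Finset (Sym2 V), Sym2 V) =>
      (⟨x.1.erase x.2, x.2⟩ : Σ _ : Finset (Sym2 V), Sym2 V)) ?_ ?_ ?_ ?_
  · rintro ⟨A, e⟩ h
    obtain ⟨hA, he⟩ := Finset.mem_sigma.1 h
    simp only at hA he
    obtain ⟨heA, heb⟩ := Finset.mem_sdiff.1 he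
    simp only [Finset.mem_sigma, Finset.mem_sdiff, mem_clusters, hsame A e he, mem_boundary]
    refine ⟨(Finset.erase_subset _ _).trans (mem_clusters.1 hA),
      ⟨mem_clusters.1 hA heA, Finset.notMem_erase _ _⟩, ?_⟩
    rintro ⟨-, z, hz, hvz⟩
    exact heb (mem_bridges.2 ⟨heA, z, hz, hvz⟩)
  · rintro ⟨A, f⟩ h ⟨A', f'⟩ h' heq
    obtain ⟨hA, hf⟩ := Finset.mem_sigma.1 (Finset.mem_coe.1 h)
    obtain ⟨hA', hf'⟩ := Finset.mem_sigma.1 (Finset.mem_coe.1 h')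
    simp only [Sigma.mk.injEq, heq_eq_eq] at heq hf hf'
    obtain ⟨e1, rfl⟩ := heq
    have := congrArg (insert f) e1
    rw [Finset.insert_erase (Finset.mem_sdiff.1 hf).1,
      Finset.insert_erase (Finset.mem_sdiff.1 hf').1] at this
    rw [this]
  · rintro ⟨A, e⟩ h
    obtain ⟨hA, he⟩ := Finset.mem_sigma.1 h
    simp only at hA he ⊢
    rw [hsame A e he]
    obtain ⟨heA, heb⟩ := Finset.mem_sdiff.1 he
    refine le_of_eq ?_
    rw [weight, weight, hsame A e he]
    have c1 := Finset.card_erase_add_one heA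
    have c2 := Finset.card_le_card (mem_clusters.1 hA)
    rw [← c1, show (touch F A v).card - (A.erase e).card =
      (touch F A v).card - ((A.erase e).card + 1) + 1 by omega, pow_succ, pow_succ]
    field_simp
  · rintro ⟨A, e⟩ _
    exact div_nonneg (mul_nonneg (weight_nonneg h0.le h1.le _ _ _) (hθ _)) hq.le

end ClusterSums

end BondPercolation

namespace BondPercolation

/-! ### Change of parameter and the green-edge estimate -/

noncomputable section GreenEstimate

open scoped Classical

variable {V : Type*}

/-- The generating function of the number of edges touching the cluster of `v`. -/
def genFun (p u : ℝ) (F : Finset (Sym2 V)) (v : V) : ℝ :=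
  ∑ A ∈ clusters F v, weight p F A v * u ^ (touch F A v).card

/-- The probability that the cluster of `v` meets a random set which contains the root and each
edge touching the cluster independently with probability `1 - u`. -/
def escape (p u : ℝ) (F : Finset (Sym2 V)) (v : V) : ℝ := 1 - u * genFun p u F v

theorem genFun_nonneg {p u : ℝ} (h0 : 0 ≤ p) (h1 : p ≤ 1) (hu0 : 0 ≤ u) (F : Finset (Sym2 V))
    (v : V) : 0 ≤ genFun p u F v :=
  Finset.sum_nonneg fun _ _ => mul_nonneg (weight_nonneg h0 h1 _ _ _) (pow_nonneg hu0 _)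

theorem genFun_le_one {p u : ℝ} (h0 : 0 ≤ p) (h1 : p ≤ 1) (hu0 : 0 ≤ u) (hu1 : u ≤ 1)
    (F : Finset (Sym2 V)) (v : V) : genFun p u F v ≤ 1 :=
  (Finset.sum_le_sum fun _ _ => mul_le_of_le_one_right (weight_nonneg h0 h1 _ _ _)
    (pow_le_one₀ hu0 hu1)).trans (sum_weight_le_one h0 h1 F v)

theorem one_sub_le_escape {p u : ℝ} (h0 : 0 ≤ p) (h1 : p ≤ 1) (hu0 : 0 ≤ u) (hu1 : u ≤ 1)
    (F : Finset (Sym2 V)) (v : V) : 1 - u ≤ escape p u F v := by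
  have := mul_le_of_le_one_right hu0 (genFun_le_one h0 h1 hu0 hu1 F v)
  rw [escape]; linarith

theorem escape_le_one {p u : ℝ} (h0 : 0 ≤ p) (h1 : p ≤ 1) (hu0 : 0 ≤ u)
    (F : Finset (Sym2 V)) (v : V) : escape p u F v ≤ 1 := by
  have := mul_nonneg hu0 (genFun_nonneg h0 h1 hu0 F v)
  rw [escape]; linarith

/-- The bracket times `x` is at most Y, the log-likelihood ratio of p - x against p plus l(o + c),
and Y ≤ e^Y - 1. The inequalities log(1-z) ≥ -z - 2z² for z ≤ 1/2 and log(1+z) ≥ z - z² have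
quadratic errors at most l/2. The other l/2 pays for the term with 1 - e^(-l). -/
theorem pow_mul_fluctuation_le {p x l : ℝ} (h0 : 0 < p) (h1 : p < 1) (hx0 : 0 < x) (hx : x ≤ p / 2)
    (hl : l = 4 * x ^ 2 / (p * (1 - p)) ^ 2) (o c : ℕ) :
    Real.exp (-l) ^ (o + c) *
        (x * (c / (1 - p) - o / p + (1 - Real.exp (-l)) * (o + c) / p)) ≤
      ((p - x) / p) ^ o * ((1 - (p - x)) / (1 - p)) ^ c - Real.exp (-l) ^ (o + c) := by
  have hq : 0 < 1 - p := sub_pos.2 h1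
  have hpx : 0 < p - x := by linarith
  have hl0 : 0 < l := by rw [hl]; positivity
  have hu : 1 - Real.exp (-l) ≤ l := by linarith [Real.add_one_le_exp (-l)]
  set a := (p - x) / p with ha
  set b := (1 - (p - x)) / (1 - p) with hb
  have ha0 : 0 < a := div_pos hpx h0
  have hb0 : 0 < b := div_pos (by linarith) hq
  have hla : 1 - a⁻¹ ≤ Real.log a := Real.one_sub_inv_le_log_of_pos ha0
  have hlb : 1 - b⁻¹ ≤ Real.log b := Real.one_sub_inv_le_log_of_pos hb0
  have hxp : x / p ≤ 1 / 2 := by rw [div_le_iff₀ h0]; linarith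
  have hxu : x * (1 - Real.exp (-l)) / p ≤ l / 2 := by
    have : x * (1 - Real.exp (-l)) / p = (x / p) * (1 - Real.exp (-l)) := by ring
    rw [this]
    have h2 : 0 ≤ 1 - Real.exp (-l) := by
      linarith [Real.exp_le_one_iff.2 (neg_nonpos.2 hl0.le)]
    nlinarith
  have hpq : 0 < p * (1 - p) := mul_pos h0 hq
  have hl1 : 4 * (x / p) ^ 2 ≤ l := by
    rw [hl, div_pow, ← mul_div_assoc]
    refine div_le_div_of_nonneg_left (by positivity) (by positivity) ?_
    exact pow_le_pow_left₀ hpq.le (by nlinarith) 2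
  have hl2 : 4 * (x / (1 - p)) ^ 2 ≤ l := by
    rw [hl, div_pow, ← mul_div_assoc]
    refine div_le_div_of_nonneg_left (by positivity) (by positivity) ?_
    exact pow_le_pow_left₀ hpq.le (by nlinarith) 2
  have hoc : x * (-1 / p + (1 - Real.exp (-l)) / p) ≤ Real.log a + l := by
    have h3 : -(x / p) - 2 * (x / p) ^ 2 ≤ 1 - a⁻¹ := by
      set z := x / p with hz
      have haz : a = 1 - z := by rw [ha, hz]; field_simp
      have hz0 : 0 < z := div_pos hx0 h0
      rw [haz, ← sub_nonneg]
      have h1z : 0 < 1 - z := by linarith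
      have : 1 - (1 - z)⁻¹ - (-z - 2 * z ^ 2) = z ^ 2 * (1 - 2 * z) / (1 - z) := by
        field_simp; ring
      rw [this]
      exact div_nonneg (mul_nonneg (sq_nonneg _) (by linarith)) h1z.le
    have h4 : x * (-1 / p + (1 - Real.exp (-l)) / p) = -(x / p) + x * (1 - Real.exp (-l)) / p := by
      ring
    rw [h4]; linarith
  have hcc : x * (1 / (1 - p) + (1 - Real.exp (-l)) / p) ≤ Real.log b + l := by
    have h3 : (x / (1 - p)) - (x / (1 - p)) ^ 2 ≤ 1 - b⁻¹ := by
      set z := x / (1 - p) with hz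
      have hbz : b = 1 + z := by rw [hb, hz]; field_simp; ring
      have hz0 : 0 < z := div_pos hx0 hq
      rw [hbz, ← sub_nonneg]
      have : 1 - (1 + z)⁻¹ - (z - z ^ 2) = z ^ 3 / (1 + z) := by
        field_simp; ring
      rw [this]; positivity
    have h4 : x * (1 / (1 - p) + (1 - Real.exp (-l)) / p) =
        x / (1 - p) + x * (1 - Real.exp (-l)) / p := by ring
    have h5 := sq_nonneg (x / (1 - p))
    rw [h4]; linarith
  have hY : x * (c / (1 - p) - o / p + (1 - Real.exp (-l)) * (o + c) / p) ≤
      o * Real.log a + c * Real.log b + l * (o + c) := by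
    have e1 := mul_le_mul_of_nonneg_left hoc (Nat.cast_nonneg (α := ℝ) o)
    have e2 := mul_le_mul_of_nonneg_left hcc (Nat.cast_nonneg (α := ℝ) c)
    have : x * (c / (1 - p) - o / p + (1 - Real.exp (-l)) * (o + c) / p) =
      o * (x * (-1 / p + (1 - Real.exp (-l)) / p)) +
        c * (x * (1 / (1 - p) + (1 - Real.exp (-l)) / p)) := by ring
    rw [this]; linarith
  have hexp : a ^ o * b ^ c = Real.exp (-l) ^ (o + c) *
      Real.exp (o * Real.log a + c * Real.log b + l * (o + c)) := by
    rw [← Real.exp_nat_mul, ← Real.exp_add]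
    push_cast
    rw [show ((o : ℝ) + c) * -l + (o * Real.log a + c * Real.log b + l * (o + c)) =
      o * Real.log a + c * Real.log b by ring, Real.exp_add, Real.exp_nat_mul, Real.exp_nat_mul,
      Real.exp_log ha0, Real.exp_log hb0]
  rw [hexp]
  have := Real.add_one_le_exp (o * Real.log a + c * Real.log b + l * (o + c))
  calc _ ≤ Real.exp (-l) ^ (o + c) *
        (Real.exp (o * Real.log a + c * Real.log b + l * (o + c)) - 1) :=
        mul_le_mul_of_nonneg_left (by linarith) (by positivity)
    _ = _ := by ring

theorem boundary_disjoint {F A : Finset (Sym2 V)} {v : V} : boundary F A v ⊆ touch F A v \ A := by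
  intro e he
  obtain ⟨he, z, hz, hvz⟩ := mem_boundary.1 he
  refine Finset.mem_sdiff.2 ⟨he, fun heA => hvz ?_⟩
  obtain ⟨-, y, hy, hvy⟩ := mem_touch.1 he
  exact hvy.of_mem heA hy hz

theorem bridges_subset (A : Finset (Sym2 V)) (v : V) : bridges A v ⊆ A := Finset.filter_subset _ _

theorem card_touch_sdiff_boundary {F A : Finset (Sym2 V)} {v : V} (hA : A ∈ clusters F v) :
    (((touch F A v \ A) \ boundary F A v).card : ℝ) =
      (touch F A v).card - A.card - (boundary F A v).card := by
  have h1 := Finset.card_sdiff_add_card_eq_card (mem_clusters.1 hA)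
  have h2 := Finset.card_sdiff_add_card_eq_card (boundary_disjoint (F := F) (A := A) (v := v))
  rw [← h1, ← h2]; push_cast; ring

theorem card_sdiff_bridges (A : Finset (Sym2 V)) (v : V) :
    ((A \ bridges A v).card : ℝ) = A.card - (bridges A v).card := by
  have h1 := Finset.card_sdiff_add_card_eq_card (bridges_subset A v)
  rw [← h1]; push_cast; ring

/-- The expected number of bridges carrying the only connection from `v` to a green edge is small
compared with the inverse of the density of green edges. -/
theorem sum_boundary_escape_le {p x l : ℝ} (h0 : 0 < p) (h1 : p < 1) (hx0 : 0 < x)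
    (hx : x ≤ p / 2) (hl : l = 4 * x ^ 2 / (p * (1 - p)) ^ 2) (F : Finset (Sym2 V)) (v : V) :
    ∑ A ∈ clusters F v, ∑ f ∈ boundary F A v,
        weight p F A v * Real.exp (-l) ^ (touch F A v).card * (p / (1 - p)) *
          escape p (Real.exp (-l)) (F \ touch F A v) (outer A v f) ≤
      p / x * escape p (Real.exp (-l)) F v := by
  have hq : 0 < 1 - p := sub_pos.2 h1
  have hl0 : 0 < l := by rw [hl]; have := mul_pos h0 hq; positivity
  set u := Real.exp (-l) with hu
  have hu0 : 0 < u := Real.exp_pos _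
  have hu1 : u ≤ 1 := Real.exp_le_one_iff.2 (neg_nonpos.2 hl0.le)
  set w := fun A => weight p F A v * u ^ (touch F A v).card with hw
  have hw0 : ∀ A, 0 ≤ w A := fun A =>
    mul_nonneg (weight_nonneg h0.le h1.le _ _ _) (pow_nonneg hu0.le _)
  have step1 := sum_bridges_le h0 h1 F v (fun A _ => u ^ (touch F A v).card)
    (fun A f B => u ^ (touch F A v).card * u ^ (touch (F \ touch F A v) B (outer A v f)).card)
    (fun A hA f hf => by rw [card_touch_split hA hf, pow_add]; rfl)
    (fun A f B => by positivity)
  have step2 := sum_nonbridges_le h0 h1 F v (fun n => u ^ n) (fun n => pow_nonneg hu0.le n)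
  -- Expanding the far escape probability as 1 - u·`genFun` yields a boundary count minus a sum over
  -- cut clusters, which `step1` bounds below by a bridge count.
  have e0 : ∑ A ∈ clusters F v, ∑ f ∈ boundary F A v,
        weight p F A v * u ^ (touch F A v).card * (p / (1 - p)) *
          escape p u (F \ touch F A v) (outer A v f) =
      ∑ A ∈ clusters F v, w A * (p / (1 - p)) * (boundary F A v).card -
      u * ∑ A ∈ clusters F v, ∑ f ∈ boundary F A v,
        ∑ B ∈ clusters (F \ touch F A v) (outer A v f),
          weight p F A v * (p / (1 - p)) * weight p (F \ touch F A v) B (outer A v f) *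
            (u ^ (touch F A v).card *
              u ^ (touch (F \ touch F A v) B (outer A v f)).card) := by
    rw [Finset.mul_sum, ← Finset.sum_sub_distrib]
    refine Finset.sum_congr rfl fun A _ => ?_
    rw [mul_comm _ ((boundary F A v).card : ℝ), ← nsmul_eq_mul, ← Finset.sum_const,
      Finset.mul_sum, ← Finset.sum_sub_distrib]
    refine Finset.sum_congr rfl fun f _ => ?_
    rw [escape, genFun, mul_sub, mul_one, Finset.mul_sum, Finset.mul_sum, Finset.mul_sum]
    congr 1
    refine Finset.sum_congr rfl fun B _ => ?_
    ring
  have e1 : ∑ A ∈ clusters F v, ∑ f ∈ bridges A v, weight p F A v * u ^ (touch F A v).card =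
      ∑ A ∈ clusters F v, w A * (bridges A v).card := by
    refine Finset.sum_congr rfl fun A _ => ?_
    rw [Finset.sum_const, nsmul_eq_mul, mul_comm]
  -- Closing non-bridges (`step2`) supplies the missing open and closed edges: boundary minus
  -- bridges is replaced by all closed minus all open edges, up to the small term with 1 - u.
  have e2 : ∑ A ∈ clusters F v, w A * (p / (1 - p)) * (boundary F A v).card -
      u * ∑ A ∈ clusters F v, w A * (bridges A v).card ≤
      p * ∑ A ∈ clusters F v, w A * (((touch F A v).card - A.card) / (1 - p) - A.card / p +
        (1 - u) * (touch F A v).card / p) := by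
    have e3 : ∑ A ∈ clusters F v, w A * (p / (1 - p)) * (boundary F A v).card -
        u * ∑ A ∈ clusters F v, w A * (bridges A v).card =
        p * ∑ A ∈ clusters F v, w A * (((touch F A v).card - A.card) / (1 - p) - A.card / p +
        (1 - u) * (bridges A v).card / p) -
        p * (∑ A ∈ clusters F v, w A *
          ((((touch F A v \ A) \ boundary F A v).card : ℝ) / (1 - p)) -
        ∑ A ∈ clusters F v, w A * (((A \ bridges A v).card : ℝ) / p)) := by
      rw [← Finset.sum_sub_distrib, Finset.mul_sum, Finset.mul_sum, Finset.mul_sum,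
        ← Finset.sum_sub_distrib, ← Finset.sum_sub_distrib]
      refine Finset.sum_congr rfl fun A hA => ?_
      rw [card_touch_sdiff_boundary hA, card_sdiff_bridges]
      field_simp
      ring
    rw [e3]
    have e4 : ∑ A ∈ clusters F v, w A * (((touch F A v).card - A.card) / (1 - p) - A.card / p +
        (1 - u) * (bridges A v).card / p) ≤
        ∑ A ∈ clusters F v, w A * (((touch F A v).card - A.card) / (1 - p) - A.card / p +
        (1 - u) * (touch F A v).card / p) := by
      refine Finset.sum_le_sum fun A hA => mul_le_mul_of_nonneg_left ?_ (hw0 A)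
      have : (bridges A v).card ≤ (touch F A v).card :=
        Finset.card_le_card ((bridges_subset A v).trans (mem_clusters.1 hA))
      have : ((bridges A v).card : ℝ) ≤ (touch F A v).card := by exact_mod_cast this
      have hu1' := sub_nonneg.2 hu1
      gcongr
    have := mul_le_mul_of_nonneg_left e4 h0.le
    have := mul_nonneg h0.le (sub_nonneg.2 step2)
    linarith
  -- Tested cluster by cluster, the fluctuation is bounded by the mass at p - x minus the damped
  -- mass at p, and the former sums to at most 1.
  have e5 : x * ∑ A ∈ clusters F v, w A * (((touch F A v).card - A.card) / (1 - p) - A.card / p +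
        (1 - u) * (touch F A v).card / p) ≤ escape p u F v := by
    have h2 : x * ∑ A ∈ clusters F v, w A * (((touch F A v).card - A.card) / (1 - p) - A.card / p +
        (1 - u) * (touch F A v).card / p) ≤
        ∑ A ∈ clusters F v, (weight (p - x) F A v - w A) := by
      rw [Finset.mul_sum]
      refine Finset.sum_le_sum fun A hA => ?_
      obtain ⟨c, hc⟩ := Nat.exists_eq_add_of_le (Finset.card_le_card (mem_clusters.1 hA))
      have hpt := mul_le_mul_of_nonneg_left (pow_mul_fluctuation_le h0 h1 hx0 hx hl A.card c)
        (weight_nonneg h0.le h1.le F A v)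
      rw [← hu] at hpt
      simp only [hw, weight, hc, Nat.add_sub_cancel_left] at hpt ⊢
      have h3 : p ^ A.card * (1 - p) ^ c * (((p - x) / p) ^ A.card *
          ((1 - (p - x)) / (1 - p)) ^ c) = (p - x) ^ A.card * (1 - (p - x)) ^ c := by
        rw [div_pow, div_pow]; field_simp
      rw [mul_sub, h3] at hpt
      push_cast
      rw [add_sub_cancel_left]
      refine le_trans (le_of_eq ?_) hpt
      ring
    refine h2.trans ?_
    rw [Finset.sum_sub_distrib]
    have h4 := sum_weight_le_one (p := p - x) (by linarith) (by linarith) F v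
    have h5 : ∑ A ∈ clusters F v, w A = genFun p u F v := rfl
    rw [h5, escape]
    have h6 := mul_le_of_le_one_left (genFun_nonneg h0.le h1.le hu0.le F v) hu1
    linarith
  rw [e0]
  rw [e1] at step1
  have h7 := mul_le_mul_of_nonneg_left step1 hu0.le
  refine le_trans (by linarith) (e2.trans ?_)
  rw [div_mul_eq_mul_div, le_div_iff₀ hx0]
  have := mul_le_mul_of_nonneg_left e5 h0.le
  linarith

end GreenEstimate

end BondPercolation

namespace BondPercolation

/-! ### Exponential moments of the edges separating two vertices -/

noncomputable section PathSums

open scoped Classical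

variable {V : Type*}

/-- This is the geometric identity (1+d)^m = 1 + d Σ_{i<m} (1+d)^i read along an ordered set: all
other elements come after the `κ`-minimal one. It lets a path be cut at each of its separating edges
in turn. -/
theorem one_add_pow_card_le {α : Type*} {d : ℝ} (hd : 0 ≤ d) (P : Finset α) (κ : α → ℕ)
    (after : α → Finset α)
    (h : ∀ g ∈ P, ∀ h ∈ P, h ≠ g → κ h < κ g ∨ h ∈ after g) :
    (1 + d) ^ P.card ≤ 1 + d * ∑ g ∈ P, (1 + d) ^ (after g).card := by
  induction hn : P.card generalizing P with
  | zero =>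
    rw [Finset.card_eq_zero.1 hn]; simp
  | succ n ih =>
    have hne : P.Nonempty := Finset.card_pos.1 (by omega)
    obtain ⟨g, hg, hmin⟩ := P.exists_min_image κ hne
    have hcard : (P.erase g).card = n := by rw [Finset.card_erase_of_mem hg, hn]; rfl
    have hsub : P.erase g ⊆ after g := fun k hk => by
      obtain ⟨hkg, hkP⟩ := Finset.mem_erase.1 hk
      exact (h g hg k hkP hkg).resolve_left (not_lt.2 (hmin k hkP))
    have h1 := ih (P.erase g) (fun a ha b hb hab => h a (Finset.mem_of_mem_erase ha) b
      (Finset.mem_of_mem_erase hb) hab) hcard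
    have h2 : (1 + d) ^ n ≤ (1 + d) ^ (after g).card := by
      rw [← hcard]
      exact pow_le_pow_right₀ (by linarith) (Finset.card_le_card hsub)
    rw [← Finset.add_sum_erase P _ hg, pow_succ]
    nlinarith [mul_le_mul_of_nonneg_left h2 hd]

/-- The vertices of the cluster of `v` in `A`. -/
def clusterVerts (A : Finset (Sym2 V)) (v : V) : Finset V :=
  (insert v (A.biUnion fun e => e.toFinset)).filter (Conn A v)

theorem mem_clusterVerts {A : Finset (Sym2 V)} {v x : V} :
    x ∈ clusterVerts A v ↔ Conn A v x := by
  simp only [clusterVerts, Finset.mem_filter, and_iff_right_iff_imp, Finset.mem_insert,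
    Finset.mem_biUnion, Sym2.mem_toFinset]
  intro h
  rcases Relation.ReflTransGen.cases_tail h with h | ⟨y, -, hy⟩
  · exact Or.inl h
  · exact Or.inr ⟨_, hy, by simp⟩

theorem card_clusterVerts_le (A : Finset (Sym2 V)) (v : V) :
    (clusterVerts A v).card ≤ 1 + 2 * A.card := by
  refine (Finset.card_filter_le _ _).trans ((Finset.card_insert_le _ _).trans ?_)
  have : (A.biUnion fun e => e.toFinset).card ≤ A.card * 2 := by
    refine Finset.card_biUnion_le_card_mul _ _ _ fun e _ => ?_
    rw [Sym2.card_toFinset]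
    split_ifs <;> simp
  omega

/-- The expected sum over the vertices `w` of the cluster of `v` of `b` to the number of edges
separating `v` from `w`, damped by `u` to the number of touching edges. -/
def pathSum (p u b : ℝ) (F : Finset (Sym2 V)) (v : V) : ℝ :=
  ∑ A ∈ clusters F v, weight p F A v * u ^ (touch F A v).card *
    ∑ w ∈ clusterVerts A v, b ^ (pivotal A v w).card

theorem conn_far_of_pivotal {F A : Finset (Sym2 V)} {v w : V} {g : Sym2 V} (hA : A ∈ clusters F v)
    (hw : Conn A v w) (hg : g ∈ pivotal A v w) : Conn (farPart A v g) (farEnd A v g) w :=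
  ((conn_iff_near_or_far hA (pivotal_subset_bridges hw hg) w).1 hw).resolve_left
    fun h => (mem_pivotal.1 hg).2 (conn_nearPart.1 h)

theorem sum_pow_pivotal_le {d : ℝ} (hd : 0 ≤ d) {F A : Finset (Sym2 V)} {v : V}
    (hA : A ∈ clusters F v) :
    ∑ w ∈ clusterVerts A v, (1 + d) ^ (pivotal A v w).card ≤
      (clusterVerts A v).card + d * ∑ g ∈ bridges A v,
        ∑ w ∈ clusterVerts (farPart A v g) (farEnd A v g),
          (1 + d) ^ (pivotal (farPart A v g) (farEnd A v g) w).card := by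
  have h1 : ∀ w ∈ clusterVerts A v, (1 + d) ^ (pivotal A v w).card ≤
      1 + d * ∑ g ∈ pivotal A v w,
        (1 + d) ^ (pivotal (farPart A v g) (farEnd A v g) w).card := fun w hw =>
    one_add_pow_card_le hd _ (fun g => (nearPart A v g).card)
      (fun g => pivotal (farPart A v g) (farEnd A v g) w) fun g hg h hh hgh =>
        card_nearPart_lt_or_mem_pivotal hA (mem_clusterVerts.1 hw) hg hh hgh
  refine (Finset.sum_le_sum h1).trans ?_
  rw [Finset.sum_add_distrib, ← Finset.mul_sum]
  simp only [Finset.sum_const, nsmul_eq_mul, mul_one]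
  refine add_le_add_right (mul_le_mul_of_nonneg_left ?_ hd) _
  simp_rw [Finset.sum_sigma']
  refine sum_le_sum_of_injOn_map (fun x : (Σ _ : V, Sym2 V) => (⟨x.2, x.1⟩ : Σ _ : Sym2 V, V))
    ?_ ?_ (fun _ _ => le_rfl) (fun _ _ => by positivity)
  · rintro ⟨w, g⟩ h
    obtain ⟨hw, hg⟩ := Finset.mem_sigma.1 h
    simp only [mem_clusterVerts] at hw hg
    exact Finset.mem_sigma.2 ⟨pivotal_subset_bridges hw hg,
      mem_clusterVerts.2 (conn_far_of_pivotal hA hw hg)⟩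
  · rintro ⟨w, g⟩ _ ⟨w', g'⟩ _ h
    simp only [Sigma.mk.injEq, heq_eq_eq] at h ⊢
    exact ⟨h.2, h.1⟩

theorem card_sdiff_touch_lt {F A : Finset (Sym2 V)} {v : V} {f : Sym2 V}
    (hf : f ∈ boundary F A v) : (F \ touch F A v).card < F.card := by
  have h1 := Finset.card_sdiff_add_card_eq_card (touch_subset F A v)
  have h2 : 0 < (touch F A v).card := Finset.card_pos.2 ⟨f, (mem_boundary.1 hf).1⟩
  omega

/-- Induction on |F|: cutting at a separating bridge leaves a far path sum in a smaller edge set.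
Keeping the factor `escape` in the bound makes the induction close, since the green estimate then
turns the far escape probabilities back into that of `v`. -/
theorem pathSum_le {p x l D : ℝ} (h0 : 0 < p) (h1 : p < 1) (hx0 : 0 < x)
    (hx : x ≤ p / 2) (hl : l = 4 * x ^ 2 / (p * (1 - p)) ^ 2)
    (hD : ∀ n : ℕ, Real.exp (-l) ^ n * (1 + 2 * n) ≤ D) (F : Finset (Sym2 V)) (v : V) :
    pathSum p (Real.exp (-l)) (1 + x / 2) F v ≤
      2 * D / (1 - Real.exp (-l)) * escape p (Real.exp (-l)) F v := by
  have hq : 0 < 1 - p := sub_pos.2 h1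
  have hl0 : 0 < l := by rw [hl]; have := mul_pos h0 hq; positivity
  have hkey := fun F v => sum_boundary_escape_le (V := V) h0 h1 hx0 hx hl F v
  set u := Real.exp (-l) with hu
  have hu0 : 0 < u := Real.exp_pos _
  have hu1 : u < 1 := by rw [hu, Real.exp_lt_one_iff]; linarith
  have hD1 : 1 ≤ D := by simpa using hD 0
  set c := 2 * D / (1 - u) with hc
  have hc0 : 0 ≤ c := div_nonneg (by linarith) (sub_nonneg.2 hu1.le)
  have hr : 0 ≤ p / (1 - p) := div_nonneg h0.le hq.le
  induction hn : F.card using Nat.strong_induction_on generalizing F v with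
  | _ n ih =>
    have hb : (0 : ℝ) ≤ x / 2 := by linarith
    have s1 : pathSum p u (1 + x / 2) F v ≤
        ∑ A ∈ clusters F v, weight p F A v * u ^ (touch F A v).card * (clusterVerts A v).card +
        x / 2 * ∑ A ∈ clusters F v, ∑ g ∈ bridges A v, weight p F A v *
          (u ^ (touch F A v).card * ∑ w ∈ clusterVerts (farPart A v g) (farEnd A v g),
          (1 + x / 2) ^ (pivotal (farPart A v g) (farEnd A v g) w).card) := by
      rw [pathSum, Finset.mul_sum, ← Finset.sum_add_distrib]
      refine Finset.sum_le_sum fun A hA => ?_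
      refine (mul_le_mul_of_nonneg_left (sum_pow_pivotal_le hb hA)
        (mul_nonneg (weight_nonneg h0.le h1.le _ _ _) (pow_nonneg hu0.le _))).trans_eq ?_
      rw [mul_add, Finset.mul_sum, Finset.mul_sum, Finset.mul_sum]
      congr 1
      refine Finset.sum_congr rfl fun g _ => ?_
      ring
    have s2 : ∑ A ∈ clusters F v,
        weight p F A v * u ^ (touch F A v).card * (clusterVerts A v).card ≤ D := by
      have : ∀ A ∈ clusters F v,
          weight p F A v * u ^ (touch F A v).card * (clusterVerts A v).card ≤
            weight p F A v * D := by
        intro A hA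
        rw [mul_assoc]
        refine mul_le_mul_of_nonneg_left ?_ (weight_nonneg h0.le h1.le _ _ _)
        refine le_trans (mul_le_mul_of_nonneg_left ?_ (pow_nonneg hu0.le _)) (hD _)
        have c1 := card_clusterVerts_le A v
        have c2 := Finset.card_le_card (mem_clusters.1 hA)
        have : (clusterVerts A v).card ≤ 1 + 2 * (touch F A v).card := by omega
        exact_mod_cast this
      refine (Finset.sum_le_sum this).trans ?_
      rw [← Finset.sum_mul]
      exact mul_le_of_le_one_left (by linarith) (sum_weight_le_one h0.le h1.le F v)
    have s3 := sum_bridges_le h0 h1 F v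
      (fun A g => u ^ (touch F A v).card * ∑ w ∈ clusterVerts (farPart A v g) (farEnd A v g),
          (1 + x / 2) ^ (pivotal (farPart A v g) (farEnd A v g) w).card)
      (fun A g B => u ^ (touch F A v).card *
        (u ^ (touch (F \ touch F A v) B (outer A v g)).card *
        ∑ w ∈ clusterVerts B (outer A v g), (1 + x / 2) ^ (pivotal B (outer A v g) w).card))
      (fun A hA f hf => by
        rw [card_touch_split hA hf, pow_add, mul_assoc]; rfl)
      (fun A f B => by positivity)
    have s4 : ∑ A ∈ clusters F v, ∑ f ∈ boundary F A v,
        ∑ B ∈ clusters (F \ touch F A v) (outer A v f),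
          weight p F A v * (p / (1 - p)) * weight p (F \ touch F A v) B (outer A v f) *
            (u ^ (touch F A v).card * (u ^ (touch (F \ touch F A v) B (outer A v f)).card *
        ∑ w ∈ clusterVerts B (outer A v f), (1 + x / 2) ^ (pivotal B (outer A v f) w).card)) ≤
        c * ∑ A ∈ clusters F v, ∑ f ∈ boundary F A v,
        weight p F A v * u ^ (touch F A v).card * (p / (1 - p)) *
          escape p u (F \ touch F A v) (outer A v f) := by
      rw [Finset.mul_sum]
      refine Finset.sum_le_sum fun A _ => ?_
      rw [Finset.mul_sum]
      refine Finset.sum_le_sum fun f hf => ?_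
      have hih := ih _ (hn ▸ card_sdiff_touch_lt hf) (F \ touch F A v) (outer A v f) rfl
      have hih' := mul_le_mul_of_nonneg_left hih (mul_nonneg (mul_nonneg
        (weight_nonneg h0.le h1.le F A v) (pow_nonneg hu0.le (touch F A v).card)) hr)
      refine le_trans (le_of_eq ?_) (hih'.trans_eq (by ring))
      rw [pathSum, Finset.mul_sum]
      refine Finset.sum_congr rfl fun B _ => ?_
      ring
    have s5 := mul_le_mul_of_nonneg_left (hkey F v) hc0
    have he := one_sub_le_escape h0.le h1.le hu0.le hu1.le F v
    have he0 : 0 ≤ escape p u F v := (sub_nonneg.2 hu1.le).trans he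
    -- Half of the constant covers the term without bridges, since the root alone gives escape ≥ 1 -
    -- u. The other half covers the recursive term, where the excess x/2 of the base over 1 meets
    -- the factor p/x.
    have s6 : D ≤ c / 2 * escape p u F v := by
      have : D = c / 2 * (1 - u) := by
        rw [hc]; field_simp [(sub_pos.2 hu1).ne']
      calc D = c / 2 * (1 - u) := this
        _ ≤ _ := mul_le_mul_of_nonneg_left he (by linarith)
    have s7 : x / 2 * (c * (p / x * escape p u F v)) ≤ c / 2 * escape p u F v := by
      have : x / 2 * (c * (p / x * escape p u F v)) = p * (c / 2 * escape p u F v) := by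
        field_simp
      rw [this]
      exact mul_le_of_le_one_left (mul_nonneg (by linarith) he0) h1.le
    have s8 := mul_le_mul_of_nonneg_left (s3.trans (s4.trans s5)) hb
    linarith

end PathSums

/-! ### Sets of several vertices, built one vertex at a time -/

noncomputable section BranchSums

open scoped Classical

variable {V : Type*}

/-- The edges of `A` separating `v` from some vertex of `W`. -/
def pivotalSet (A : Finset (Sym2 V)) (v : V) (W : Finset V) : Finset (Sym2 V) :=
  W.biUnion (pivotal A v)

/-- Since `f` separates no vertex of `W`, the near part already connects `v` to all of `W`. Any edge
separating `v` from `W` must therefore lie in it. -/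
theorem pivotalSet_subset_nearPart {A : Finset (Sym2 V)} {v : V} {f : Sym2 V} {W : Finset V}
    (hf : f ∉ pivotalSet A v W) (hfA : f ∈ A) :
    (∀ w ∈ W, Conn (nearPart A v f) v w) ∧
      pivotalSet A v W ⊆ pivotalSet (nearPart A v f) v W := by
  have h1 : ∀ w ∈ W, Conn (nearPart A v f) v w := by
    intro w hw
    by_contra hc
    exact hf (Finset.mem_biUnion.2 ⟨w, hw, mem_pivotal.2 ⟨hfA, fun h => hc (conn_nearPart.2 h)⟩⟩)
  refine ⟨h1, fun e he => ?_⟩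
  obtain ⟨w, hw, he⟩ := Finset.mem_biUnion.1 he
  obtain ⟨heA, he⟩ := mem_pivotal.1 he
  have hcon : ¬ Conn ((nearPart A v f).erase e) v w := fun h => he (h.mono
    (Finset.erase_subset_erase _ (nearPart_subset.trans (Finset.erase_subset _ _))))
  refine Finset.mem_biUnion.2 ⟨w, hw, mem_pivotal.2 ⟨?_, hcon⟩⟩
  by_contra hen
  rw [Finset.erase_eq_of_notMem hen] at hcon
  exact hcon (h1 w hw)

/-- Adding a vertex `w` to `W` either creates no new separating edge, or all the new ones lie behind
a bridge separating `w` from `W`. -/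
theorem pow_card_pivotalSet_insert_le {b : ℝ} (hb : 1 ≤ b) {F A : Finset (Sym2 V)} {v w : V}
    {W : Finset V} (hA : A ∈ clusters F v) (hw : Conn A v w) :
    b ^ (pivotalSet A v (insert w W)).card ≤ b ^ (pivotalSet A v W).card +
      ∑ f ∈ bridges A v, if W ⊆ clusterVerts (nearPart A v f) v ∧
          w ∈ clusterVerts (farPart A v f) (farEnd A v f) then
        b ^ (pivotalSet (nearPart A v f) v W).card * b *
          b ^ (pivotal (farPart A v f) (farEnd A v f) w).card else 0 := by
  have hb0 : 0 ≤ b := by linarith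
  have hterm : ∀ f ∈ bridges A v, 0 ≤ (if W ⊆ clusterVerts (nearPart A v f) v ∧
          w ∈ clusterVerts (farPart A v f) (farEnd A v f) then
        b ^ (pivotalSet (nearPart A v f) v W).card * b *
          b ^ (pivotal (farPart A v f) (farEnd A v f) w).card else 0) := by
    intro f _; split_ifs <;> positivity
  have hins : pivotalSet A v (insert w W) = pivotal A v w ∪ pivotalSet A v W := by
    rw [pivotalSet, Finset.biUnion_insert]; rfl
  by_cases hsub : pivotal A v w ⊆ pivotalSet A v W
  · rw [hins, Finset.union_eq_right.2 hsub]
    linarith [Finset.sum_nonneg hterm]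
  · have hne : (pivotal A v w \ pivotalSet A v W).Nonempty := Finset.sdiff_nonempty.2 hsub
    -- `f` is the new separating edge nearest to the root, so all other new ones lie beyond it.
    obtain ⟨f, hf, hmin⟩ := Finset.exists_min_image _ (fun f => (nearPart A v f).card) hne
    obtain ⟨hfw, hfW⟩ := Finset.mem_sdiff.1 hf
    have hfb := pivotal_subset_bridges hw hfw
    obtain ⟨hconn, hsubW⟩ := pivotalSet_subset_nearPart hfW (mem_pivotal.1 hfw).1
    have hcard : (pivotalSet A v (insert w W)).card ≤
        (pivotalSet (nearPart A v f) v W).card + 1 +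
          (pivotal (farPart A v f) (farEnd A v f) w).card := by
      have hcov : pivotalSet A v (insert w W) ⊆ insert f (pivotalSet A v W) ∪
          pivotal (farPart A v f) (farEnd A v f) w := by
        rw [hins]
        intro e he
        rw [Finset.mem_union, Finset.mem_insert]
        by_cases heW : e ∈ pivotalSet A v W
        · exact Or.inl (Or.inr heW)
        · have hew := (Finset.mem_union.1 he).resolve_right heW
          by_cases hef : e = f
          · exact Or.inl (Or.inl hef)
          · refine Or.inr ((card_nearPart_lt_or_mem_pivotal hA hw hfw hew hef).resolve_left ?_)
            exact not_lt.2 (hmin e (Finset.mem_sdiff.2 ⟨hew, heW⟩))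
      refine (Finset.card_le_card hcov).trans ((Finset.card_union_le _ _).trans ?_)
      have := Finset.card_insert_le f (pivotalSet A v W)
      have := Finset.card_le_card hsubW
      omega
    have hle := Finset.single_le_sum hterm hfb
    rw [if_pos ⟨fun x hx => mem_clusterVerts.2 (hconn x hx),
      mem_clusterVerts.2 (conn_far_of_pivotal hA hw hfw)⟩] at hle
    have hpow := pow_le_pow_right₀ hb hcard
    rw [pow_add, pow_succ] at hpow
    have : 0 ≤ b ^ (pivotalSet A v W).card := by positivity
    linarith

/-- Each set of size j + 1 arises from j + 1 choices of its last vertex; this factor builds the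
factorial in `branchSum_le`. -/
theorem succ_mul_sum_powersetCard_le {α : Type*} (s : Finset α) (j : ℕ) (θ : Finset α → ℝ)
    (hθ : ∀ W, 0 ≤ θ W) :
    (j + 1 : ℝ) * ∑ W ∈ s.powersetCard (j + 1), θ W ≤
      ∑ W ∈ s.powersetCard j, ∑ w ∈ s, θ (insert w W) := by
  have h1 : (j + 1 : ℝ) * ∑ W ∈ s.powersetCard (j + 1), θ W =
      ∑ W ∈ s.powersetCard (j + 1), ∑ _w ∈ W, θ W := by
    rw [Finset.mul_sum]
    refine Finset.sum_congr rfl fun W hW => ?_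
    rw [Finset.sum_const, (Finset.mem_powersetCard.1 hW).2, nsmul_eq_mul]
    push_cast; ring
  rw [h1]
  simp_rw [Finset.sum_sigma']
  refine sum_le_sum_of_injOn_map
    (fun x : (Σ _ : Finset α, α) => (⟨x.1.erase x.2, x.2⟩ : Σ _ : Finset α, α)) ?_ ?_ ?_
    (fun _ _ => hθ _)
  · rintro ⟨W, w⟩ h
    obtain ⟨hW, hw⟩ := Finset.mem_sigma.1 h
    obtain ⟨hWs, hWc⟩ := Finset.mem_powersetCard.1 hW
    simp only at hw hWs hWc
    refine Finset.mem_sigma.2 ⟨Finset.mem_powersetCard.2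
      ⟨(Finset.erase_subset _ _).trans hWs, ?_⟩, hWs hw⟩
    simp [Finset.card_erase_of_mem hw, hWc]
  · rintro ⟨W, w⟩ h ⟨W', w'⟩ h' heq
    have hw := (Finset.mem_sigma.1 (Finset.mem_coe.1 h)).2
    have hw' := (Finset.mem_sigma.1 (Finset.mem_coe.1 h')).2
    simp only [Sigma.mk.injEq, heq_eq_eq] at heq hw hw'
    obtain ⟨e1, rfl⟩ := heq
    have := congrArg (insert w) e1
    rw [Finset.insert_erase hw, Finset.insert_erase hw'] at this
    rw [this]
  · rintro ⟨W, w⟩ h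
    have hw := (Finset.mem_sigma.1 h).2
    simp only at hw ⊢
    rw [Finset.insert_erase hw]

/-- The sum over `W ⊆ C(A)` with `|W| = j` of `b` to the number of separating edges. -/
def branchWeight (b : ℝ) (j : ℕ) (A : Finset (Sym2 V)) (v : V) : ℝ :=
  ∑ W ∈ (clusterVerts A v).powersetCard j, b ^ (pivotalSet A v W).card

theorem branchWeight_nonneg {b : ℝ} (hb : 0 ≤ b) (j : ℕ) (A : Finset (Sym2 V)) (v : V) :
    0 ≤ branchWeight b j A v := Finset.sum_nonneg fun _ _ => pow_nonneg hb _

theorem succ_mul_branchWeight_le {b : ℝ} (hb : 1 ≤ b) (j : ℕ) {F A : Finset (Sym2 V)} {v : V}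
    (hA : A ∈ clusters F v) :
    (j + 1 : ℝ) * branchWeight b (j + 1) A v ≤
      (clusterVerts A v).card * branchWeight b j A v +
      ∑ f ∈ bridges A v, branchWeight b j (nearPart A v f) v * b *
        ∑ w ∈ clusterVerts (farPart A v f) (farEnd A v f),
          b ^ (pivotal (farPart A v f) (farEnd A v f) w).card := by
  have hb0 : 0 ≤ b := by linarith
  refine (succ_mul_sum_powersetCard_le _ _ (fun W => b ^ (pivotalSet A v W).card)
    (fun W => pow_nonneg hb0 _)).trans ?_
  refine (Finset.sum_le_sum fun W _ => Finset.sum_le_sum fun w hw =>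
    pow_card_pivotalSet_insert_le hb hA (mem_clusterVerts.1 hw)).trans ?_
  simp_rw [Finset.sum_add_distrib]
  refine add_le_add (le_of_eq ?_) ?_
  · rw [branchWeight, Finset.mul_sum]
    refine Finset.sum_congr rfl fun W _ => ?_
    rw [Finset.sum_const, nsmul_eq_mul]
  · have hswap : ∀ (S : Finset (Finset V)) (T : Finset V) (B : Finset (Sym2 V))
        (θ : Finset V → V → Sym2 V → ℝ), ∑ W ∈ S, ∑ w ∈ T, ∑ f ∈ B, θ W w f =
          ∑ f ∈ B, ∑ W ∈ S, ∑ w ∈ T, θ W w f := by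
      intro S T B θ
      rw [Finset.sum_comm (s := B)]
      exact Finset.sum_congr rfl fun W _ => Finset.sum_comm
    rw [hswap]
    refine Finset.sum_le_sum fun f _ => ?_
    rw [branchWeight, Finset.sum_mul, Finset.sum_mul]
    simp_rw [Finset.mul_sum]
    rw [← Finset.sum_product', ← Finset.sum_product', ← Finset.sum_filter]
    refine Finset.sum_le_sum_of_subset_of_nonneg ?_ fun _ _ _ => by positivity
    rintro ⟨W, w⟩ h
    simp only [Finset.mem_filter, Finset.mem_product, Finset.mem_powersetCard] at h ⊢
    exact ⟨⟨h.2.1, h.1.1.2⟩, h.2.2⟩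

/-- `u ^ m`, truncated to `m ≤ n`. -/
def truncPow (u : ℝ) (n m : ℕ) : ℝ := if m ≤ n then u ^ m else 0

theorem truncPow_nonneg {u : ℝ} (hu : 0 ≤ u) (n m : ℕ) : 0 ≤ truncPow u n m := by
  rw [truncPow]; split_ifs <;> positivity

theorem truncPow_add_le {u : ℝ} (hu : 0 ≤ u) (n m k : ℕ) :
    truncPow u n (m + k) ≤ truncPow u n m * u ^ k := by
  rw [truncPow, truncPow]
  split_ifs with h1 h2
  · rw [pow_add]
  · omega
  · positivity
  · simp

/-- The expectation of `branchWeight` over clusters with at most `n` touching edges, damped by `u`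
to the number of touching edges. -/
def branchSum (p u b : ℝ) (n j : ℕ) (F : Finset (Sym2 V)) (v : V) : ℝ :=
  ∑ A ∈ clusters F v, weight p F A v * truncPow u n (touch F A v).card * branchWeight b j A v

theorem branchSum_zero_le {p u b : ℝ} (h0 : 0 ≤ p) (h1 : p ≤ 1) (hu0 : 0 ≤ u) (hu1 : u ≤ 1)
    (n : ℕ) (F : Finset (Sym2 V)) (v : V) : branchSum p u b n 0 F v ≤ 1 := by
  refine (Finset.sum_le_sum fun A _ => ?_).trans (sum_weight_le_one h0 h1 F v)
  have : branchWeight b 0 A v = 1 := by simp [branchWeight, pivotalSet]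
  rw [this, mul_one]
  refine mul_le_of_le_one_right (weight_nonneg h0 h1 _ _ _) ?_
  rw [truncPow]
  split_ifs
  · exact pow_le_one₀ hu0 hu1
  · exact zero_le_one

/-- A new vertex without new separating edges has at most 1 + 2n positions. Otherwise the cluster is
cut at one of at most n boundary edges of the near part, and the far side costs at most `K`. The
truncation at n survives cutting, while the damping factorises and feeds the far path sum. -/
theorem succ_mul_branchSum_le {p u b K : ℝ} (h0 : 0 < p) (h1 : p < 1) (hu0 : 0 ≤ u)
    (hb : 1 ≤ b) (hK : ∀ (F : Finset (Sym2 V)) (v : V), pathSum p u b F v ≤ K) (n j : ℕ)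
    (F : Finset (Sym2 V)) (v : V) :
    (j + 1 : ℝ) * branchSum p u b n (j + 1) F v ≤
      (1 + 2 * n + n * (b * (p / (1 - p)) * K)) * branchSum p u b n j F v := by
  have hq : 0 < 1 - p := sub_pos.2 h1
  have hr : 0 ≤ p / (1 - p) := div_nonneg h0.le hq.le
  have hb0 : 0 ≤ b := by linarith
  have hK0 : 0 ≤ K := le_trans (Finset.sum_nonneg fun A _ => mul_nonneg (mul_nonneg
    (weight_nonneg h0.le h1.le _ _ _) (pow_nonneg hu0 _))
    (Finset.sum_nonneg fun _ _ => pow_nonneg hb0 _)) (hK F v)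
  have hw0 : ∀ A, 0 ≤ weight p F A v * truncPow u n (touch F A v).card := fun A =>
    mul_nonneg (weight_nonneg h0.le h1.le _ _ _) (truncPow_nonneg hu0 _ _)
  have s1 : (j + 1 : ℝ) * branchSum p u b n (j + 1) F v ≤
      ∑ A ∈ clusters F v, weight p F A v * truncPow u n (touch F A v).card *
        ((clusterVerts A v).card * branchWeight b j A v) +
      ∑ A ∈ clusters F v, ∑ f ∈ bridges A v, weight p F A v *
        (truncPow u n (touch F A v).card * (branchWeight b j (nearPart A v f) v * b *
        ∑ w ∈ clusterVerts (farPart A v f) (farEnd A v f),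
          b ^ (pivotal (farPart A v f) (farEnd A v f) w).card)) := by
    rw [branchSum, Finset.mul_sum, ← Finset.sum_add_distrib]
    refine Finset.sum_le_sum fun A hA => ?_
    have := mul_le_mul_of_nonneg_left (succ_mul_branchWeight_le hb j hA) (hw0 A)
    rw [mul_add, Finset.mul_sum] at this
    refine le_trans (le_of_eq (by ring)) (this.trans_eq ?_)
    congr 1
    exact Finset.sum_congr rfl fun f _ => by ring
  have s2 : ∑ A ∈ clusters F v, weight p F A v * truncPow u n (touch F A v).card *
        ((clusterVerts A v).card * branchWeight b j A v) ≤
      (1 + 2 * n) * branchSum p u b n j F v := by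
    rw [branchSum, Finset.mul_sum]
    refine Finset.sum_le_sum fun A hA => ?_
    by_cases hn : (touch F A v).card ≤ n
    · have c1 := card_clusterVerts_le A v
      have c2 := Finset.card_le_card (mem_clusters.1 hA)
      have c3 : (clusterVerts A v).card ≤ 1 + 2 * n := by omega
      have c4 : ((clusterVerts A v).card : ℝ) ≤ 1 + 2 * n := by exact_mod_cast c3
      have c5 := mul_nonneg (hw0 A) (branchWeight_nonneg hb0 j A v)
      calc _ = (clusterVerts A v).card * (weight p F A v * truncPow u n (touch F A v).card *
            branchWeight b j A v) := by ring
        _ ≤ _ := mul_le_mul_of_nonneg_right c4 c5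
    · simp [truncPow, hn]
  have s3 := sum_bridges_le h0 h1 F v
    (fun A f => truncPow u n (touch F A v).card * (branchWeight b j (nearPart A v f) v * b *
        ∑ w ∈ clusterVerts (farPart A v f) (farEnd A v f),
          b ^ (pivotal (farPart A v f) (farEnd A v f) w).card))
    (fun A f B => (truncPow u n (touch F A v).card *
      u ^ (touch (F \ touch F A v) B (outer A v f)).card) * (branchWeight b j A v * b *
        ∑ w ∈ clusterVerts B (outer A v f), b ^ (pivotal B (outer A v f) w).card))
    (fun A hA f hf => by
      rw [card_touch_split hA hf]
      exact mul_le_mul_of_nonneg_right (truncPow_add_le hu0 _ _ _)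
        (mul_nonneg (mul_nonneg (branchWeight_nonneg hb0 _ _ _) hb0)
          (Finset.sum_nonneg fun _ _ => pow_nonneg hb0 _)))
    (fun A f B => mul_nonneg (mul_nonneg (truncPow_nonneg hu0 _ _) (pow_nonneg hu0 _))
      (mul_nonneg (mul_nonneg (branchWeight_nonneg hb0 _ _ _) hb0)
          (Finset.sum_nonneg fun _ _ => pow_nonneg hb0 _)))
  have s4 : ∑ A ∈ clusters F v, ∑ f ∈ boundary F A v,
        ∑ B ∈ clusters (F \ touch F A v) (outer A v f),
          weight p F A v * (p / (1 - p)) * weight p (F \ touch F A v) B (outer A v f) *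
            ((truncPow u n (touch F A v).card *
      u ^ (touch (F \ touch F A v) B (outer A v f)).card) * (branchWeight b j A v * b *
        ∑ w ∈ clusterVerts B (outer A v f), b ^ (pivotal B (outer A v f) w).card)) ≤
      n * (b * (p / (1 - p)) * K) * branchSum p u b n j F v := by
    rw [branchSum, Finset.mul_sum]
    refine Finset.sum_le_sum fun A hA => ?_
    set m := weight p F A v * truncPow u n (touch F A v).card * branchWeight b j A v with hm
    have hm0 : 0 ≤ m := mul_nonneg (hw0 A) (branchWeight_nonneg hb0 j A v)
    have t1 : ∑ f ∈ boundary F A v, ∑ B ∈ clusters (F \ touch F A v) (outer A v f),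
          weight p F A v * (p / (1 - p)) * weight p (F \ touch F A v) B (outer A v f) *
            ((truncPow u n (touch F A v).card *
      u ^ (touch (F \ touch F A v) B (outer A v f)).card) * (branchWeight b j A v * b *
        ∑ w ∈ clusterVerts B (outer A v f), b ^ (pivotal B (outer A v f) w).card)) =
        ∑ f ∈ boundary F A v, m * (b * (p / (1 - p))) *
          pathSum p u b (F \ touch F A v) (outer A v f) := by
      refine Finset.sum_congr rfl fun f _ => ?_
      rw [pathSum, Finset.mul_sum]
      refine Finset.sum_congr rfl fun B _ => ?_
      rw [hm]; ring
    have hmb : 0 ≤ m * (b * (p / (1 - p))) := mul_nonneg hm0 (mul_nonneg hb0 hr)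
    rw [t1]
    refine (Finset.sum_le_sum fun f _ => mul_le_mul_of_nonneg_left (hK _ _) hmb).trans ?_
    rw [Finset.sum_const, nsmul_eq_mul]
    by_cases hn : (touch F A v).card ≤ n
    · have c1 : (boundary F A v).card ≤ n :=
        (Finset.card_le_card (Finset.filter_subset _ _)).trans hn
      have c2 : ((boundary F A v).card : ℝ) ≤ n := by exact_mod_cast c1
      calc _ ≤ (n : ℝ) * (m * (b * (p / (1 - p))) * K) :=
            mul_le_mul_of_nonneg_right c2 (mul_nonneg hmb hK0)
        _ = _ := by ring
    · simp [hm, truncPow, hn]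
  linarith

theorem branchSum_le {p u b K : ℝ} (h0 : 0 < p) (h1 : p < 1) (hu0 : 0 ≤ u) (hu1 : u ≤ 1)
    (hb : 1 ≤ b) (hK : ∀ (F : Finset (Sym2 V)) (v : V), pathSum p u b F v ≤ K) (n j : ℕ)
    (F : Finset (Sym2 V)) (v : V) :
    branchSum p u b n j F v ≤ (1 + 2 * n + n * (b * (p / (1 - p)) * K)) ^ j / j.factorial := by
  have hb0 : 0 ≤ b := by linarith
  have hr : 0 ≤ p / (1 - p) := div_nonneg h0.le (sub_nonneg.2 h1.le)
  have hK0 : 0 ≤ K := le_trans (Finset.sum_nonneg fun A _ => mul_nonneg (mul_nonneg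
    (weight_nonneg h0.le h1.le _ _ _) (pow_nonneg hu0 _))
    (Finset.sum_nonneg fun _ _ => pow_nonneg hb0 _)) (hK F v)
  induction j with
  | zero => simpa using branchSum_zero_le h0.le h1.le hu0 hu1 n F v
  | succ j ih =>
    have h := succ_mul_branchSum_le h0 h1 hu0 hb hK n j F v
    have hj : (0 : ℝ) < j + 1 := by positivity
    have hc : 0 ≤ 1 + 2 * (n : ℝ) + n * (b * (p / (1 - p)) * K) := by positivity
    have h2 := h.trans (mul_le_mul_of_nonneg_left ih hc)
    rw [Nat.factorial_succ, Nat.cast_mul, le_div_iff₀ (by positivity)]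
    have hf : (0 : ℝ) < j.factorial := by positivity
    rw [← mul_div_assoc, le_div_iff₀ hf, ← pow_succ'] at h2
    push_cast
    linarith

end BranchSums

end BondPercolation

namespace BondPercolation

/-! ### Exponential decay in finite volume -/

noncomputable section FiniteVolume

open scoped Classical

variable {V : Type*}

theorem exp_pow_mul_one_add_le {l : ℝ} (hl : 0 < l) (n : ℕ) :
    Real.exp (-l) ^ n * (1 + 2 * n) ≤ 1 + 2 / l := by
  have h1 : Real.exp (-l) ^ n ≤ 1 :=
    pow_le_one₀ (Real.exp_pos _).le (Real.exp_le_one_iff.2 (by linarith))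
  have h2 : Real.exp (-l) ^ n * n ≤ 1 / l := by
    rw [le_div_iff₀ hl, ← Real.exp_nat_mul, mul_assoc]
    have h3 := Real.add_one_le_exp (n * l)
    have h4 : Real.exp (n * -l) * Real.exp (n * l) = 1 := by
      rw [← Real.exp_add]; simp
    have h5 : 0 < Real.exp (n * -l) := Real.exp_pos _
    nlinarith
  have : 2 / l = 2 * (1 / l) := by ring
  linarith

/-- The generating function of the sets `W` of vertices of the cluster, each weighted by `b` to the
number of edges separating `v` from `W`. -/
def branchGen (z b : ℝ) (A : Finset (Sym2 V)) (v : V) : ℝ :=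
  ∑ W ∈ (clusterVerts A v).powerset, z ^ W.card * b ^ (pivotalSet A v W).card

theorem branchGen_le {z b : ℝ} (hz : 0 ≤ z) (hb : 0 ≤ b) {A : Finset (Sym2 V)} {v : V} {N : ℕ}
    (hN : (clusterVerts A v).card < N) :
    branchGen z b A v ≤ ∑ j ∈ Finset.range N, z ^ j * branchWeight b j A v := by
  rw [branchGen, Finset.sum_powerset]
  have h : ∀ j ∈ Finset.range ((clusterVerts A v).card + 1),
      ∑ W ∈ (clusterVerts A v).powersetCard j, z ^ W.card * b ^ (pivotalSet A v W).card =
        z ^ j * branchWeight b j A v := by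
    intro j _
    rw [branchWeight, Finset.mul_sum]
    refine Finset.sum_congr rfl fun W hW => ?_
    rw [(Finset.mem_powersetCard.1 hW).2]
  rw [Finset.sum_congr rfl h]
  refine Finset.sum_le_sum_of_subset_of_nonneg (Finset.range_mono hN) fun j _ _ => ?_
  exact mul_nonneg (pow_nonneg hz _) (branchWeight_nonneg hb _ _ _)

theorem sum_pow_div_factorial_le_exp {y : ℝ} (hy : 0 ≤ y) (N : ℕ) :
    ∑ j ∈ Finset.range N, y ^ j / j.factorial ≤ Real.exp y :=
  Real.sum_le_exp_of_nonneg hy N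

theorem sum_weight_branchGen_le {p l b K z : ℝ} (h0 : 0 < p) (h1 : p < 1) (hl : 0 ≤ l)
    (hb : 1 ≤ b) (hz : 0 ≤ z)
    (hK : ∀ (F : Finset (Sym2 V)) (v : V), pathSum p (Real.exp (-l)) b F v ≤ K)
    {n : ℕ} (hn : 1 ≤ n) (F : Finset (Sym2 V)) (v : V) :
    ∑ A ∈ (clusters F v).filter (fun A => (touch F A v).card = n),
        weight p F A v * branchGen z b A v ≤
      Real.exp (l * n + z * ((3 + b * (p / (1 - p)) * K) * n)) := by
  have hb0 : 0 ≤ b := by linarith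
  have hr : 0 ≤ p / (1 - p) := div_nonneg h0.le (sub_nonneg.2 h1.le)
  have hu0 : 0 < Real.exp (-l) := Real.exp_pos _
  have hu1 : Real.exp (-l) ≤ 1 := Real.exp_le_one_iff.2 (by linarith)
  have hK0 : 0 ≤ K := le_trans (Finset.sum_nonneg fun A _ => mul_nonneg (mul_nonneg
    (weight_nonneg h0.le h1.le _ _ _) (pow_nonneg hu0.le _))
    (Finset.sum_nonneg fun _ _ => pow_nonneg hb0 _)) (hK F v)
  set c := 3 + b * (p / (1 - p)) * K with hc
  have hn' : (1 : ℝ) ≤ n := by exact_mod_cast hn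
  -- The factor exp(l n) undoes the damping on clusters with exactly n touching edges. These have at
  -- most 1 + 2n vertices, so j < 2n + 2 covers all subsets.
  have s1 : ∑ A ∈ (clusters F v).filter (fun A => (touch F A v).card = n),
        weight p F A v * branchGen z b A v ≤
      Real.exp (l * n) * ∑ j ∈ Finset.range (2 * n + 2),
        z ^ j * branchSum p (Real.exp (-l)) b n j F v := by
    have t1 : ∀ A ∈ (clusters F v).filter (fun A => (touch F A v).card = n),
        weight p F A v * branchGen z b A v ≤ Real.exp (l * n) * ∑ j ∈ Finset.range (2 * n + 2),
          z ^ j * (weight p F A v * truncPow (Real.exp (-l)) n (touch F A v).card *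
            branchWeight b j A v) := by
      intro A hA
      obtain ⟨hA, hAn⟩ := Finset.mem_filter.1 hA
      have c1 := card_clusterVerts_le A v
      have c2 := Finset.card_le_card (mem_clusters.1 hA)
      have t2 := mul_le_mul_of_nonneg_left
        (branchGen_le hz hb0 (A := A) (v := v) (N := 2 * n + 2) (by omega))
        (weight_nonneg h0.le h1.le F A v)
      refine t2.trans_eq ?_
      rw [Finset.mul_sum, Finset.mul_sum]
      refine Finset.sum_congr rfl fun j _ => ?_
      rw [truncPow, if_pos hAn.le, hAn, ← Real.exp_nat_mul]
      have : Real.exp (l * n) * Real.exp (n * -l) = 1 := by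
        rw [← Real.exp_add, show l * n + n * -l = 0 by ring, Real.exp_zero]
      calc _ = (Real.exp (l * n) * Real.exp (n * -l)) *
            (weight p F A v * (z ^ j * branchWeight b j A v)) := by rw [this, one_mul]
        _ = _ := by ring
    refine (Finset.sum_le_sum t1).trans ?_
    rw [← Finset.mul_sum]
    refine mul_le_mul_of_nonneg_left ?_ (Real.exp_pos _).le
    rw [Finset.sum_comm]
    refine Finset.sum_le_sum fun j _ => ?_
    rw [← Finset.mul_sum]
    refine mul_le_mul_of_nonneg_left ?_ (pow_nonneg hz _)
    refine Finset.sum_le_sum_of_subset_of_nonneg (Finset.filter_subset _ _) fun A _ _ => ?_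
    exact mul_nonneg (mul_nonneg (weight_nonneg h0.le h1.le _ _ _) (truncPow_nonneg hu0.le _ _))
      (branchWeight_nonneg hb0 _ _ _)
  refine s1.trans ?_
  rw [Real.exp_add]
  refine mul_le_mul_of_nonneg_left ?_ (Real.exp_pos _).le
  refine le_trans (Finset.sum_le_sum fun j _ => ?_)
    (sum_pow_div_factorial_le_exp (y := z * (c * n)) (by positivity) (2 * n + 2))
  rw [mul_pow, mul_div_assoc]
  refine mul_le_mul_of_nonneg_left ?_ (pow_nonneg hz _)
  refine (branchSum_le h0 h1 hu0.le hu1 hb hK n j F v).trans ?_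
  have : 1 + 2 * (n : ℝ) + n * (b * (p / (1 - p)) * K) ≤ c * n := by
    rw [hc]; nlinarith
  gcongr

/-- Finite-volume form of the estimate: clusters in which a small number of vertices are separated
from the root by a positive fraction of the edges are exponentially rare, uniformly in the graph. -/
theorem exists_sum_weight_branchGen_le.{u} {α p : ℝ} (hα : 0 < α) (h0 : 0 < p) (h1 : p < 1) :
    ∃ b τ z C : ℝ, 1 < b ∧ 0 < τ ∧ 0 < z ∧ z ≤ 1 ∧
      ∀ (V : Type u) (F : Finset (Sym2 V)) (v : V),
        ∑ A ∈ clusters F v, weight p F A v * ((touch F A v).card *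
          Real.exp ((τ - α * Real.log b) * (touch F A v).card) * branchGen z b A v) ≤ C := by
  have hq : 0 < 1 - p := sub_pos.2 h1
  have hpq : 0 < p * (1 - p) := mul_pos h0 hq
  -- The condition 32x ≤ α(p(1-p))² is exactly l ≤ g for g = αx/8, while log b ≥ x/4 gives α log b ≥
  -- 2g.
  obtain ⟨x, hx0, hxp, hxα⟩ : ∃ x : ℝ, 0 < x ∧ x ≤ p / 2 ∧ 32 * x ≤ α * (p * (1 - p)) ^ 2 := by
    refine ⟨min (p / 2) (α * (p * (1 - p)) ^ 2 / 32), lt_min (by linarith) (by positivity),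
      min_le_left _ _, ?_⟩
    have := min_le_right (p / 2) (α * (p * (1 - p)) ^ 2 / 32)
    linarith
  obtain ⟨l, hl⟩ : ∃ l, l = 4 * x ^ 2 / (p * (1 - p)) ^ 2 := ⟨_, rfl⟩
  have hl0 : 0 < l := by rw [hl]; positivity
  set g := α * x / 8 with hg
  have hg0 : 0 < g := by positivity
  have hlg : l ≤ g := by
    rw [hl, hg, div_le_div_iff₀ (by positivity) (by norm_num)]
    nlinarith
  set b := 1 + x / 2 with hb
  have hb1 : 1 < b := by linarith
  have hlogb : 2 * g ≤ α * Real.log b := by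
    have e1 := Real.one_sub_inv_le_log_of_pos (show 0 < b by linarith)
    have e2 : x / 4 ≤ 1 - b⁻¹ := by
      have : 1 - b⁻¹ = (x / 2) / (1 + x / 2) := by rw [hb]; field_simp; ring
      rw [this, le_div_iff₀ (by linarith)]
      nlinarith
    have := mul_le_mul_of_nonneg_left (e2.trans e1) hα.le
    rw [hg]; linarith
  set K := 2 * (1 + 2 / l) / (1 - Real.exp (-l)) with hKdef
  have hu1 : Real.exp (-l) < 1 := by rw [Real.exp_lt_one_iff]; linarith
  have hK0 : 0 ≤ K := div_nonneg (by positivity) (sub_nonneg.2 hu1.le)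
  have hK : ∀ (V : Type u) (F : Finset (Sym2 V)) (v : V), pathSum p (Real.exp (-l)) b F v ≤ K :=
    fun V F v => (pathSum_le h0 h1 hx0 hxp hl (exp_pow_mul_one_add_le hl0) F v).trans
      (mul_le_of_le_one_right hK0 (escape_le_one h0.le h1.le (Real.exp_pos _).le F v))
  set c := 3 + b * (p / (1 - p)) * K with hc
  have hc0 : 0 < c := by positivity
  set ρ := Real.exp (-(g / 2)) with hρ
  have hρ1 : ρ < 1 := by rw [hρ, Real.exp_lt_one_iff]; linarith
  have hsum : Summable fun n : ℕ => (n : ℝ) * ρ ^ n := by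
    have := summable_pow_mul_geometric_of_norm_lt_one 1 (r := ρ)
      (by rw [Real.norm_of_nonneg (Real.exp_pos _).le]; exact hρ1)
    simpa using this
  refine ⟨b, g / 4, min 1 (g / (4 * c)), ∑' n : ℕ, (n : ℝ) * ρ ^ n, hb1, by linarith,
    lt_min one_pos (by positivity), min_le_left _ _, fun V F v => ?_⟩
  set z := min 1 (g / (4 * c)) with hz
  have hz0 : 0 ≤ z := (lt_min one_pos (by positivity)).le
  have hzc : z * c ≤ g / 4 := by
    have : z ≤ g / (4 * c) := min_le_right _ _
    rw [le_div_iff₀ (by positivity)] at this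
    linarith
  rw [← Finset.sum_fiberwise_of_maps_to (t := Finset.range (F.card + 1))
    (g := fun A => (touch F A v).card)
    (fun A _ => Finset.mem_range.2 (Nat.lt_succ_of_le (Finset.card_le_card (touch_subset _ _ _))))]
  refine le_trans (Finset.sum_le_sum fun n _ => ?_) (hsum.sum_le_tsum _ fun n _ => by positivity)
  have t1 : ∀ A ∈ (clusters F v).filter (fun A => (touch F A v).card = n),
      weight p F A v * ((touch F A v).card *
        Real.exp ((g / 4 - α * Real.log b) * (touch F A v).card) * branchGen z b A v) =
      (n * Real.exp ((g / 4 - α * Real.log b) * n)) * (weight p F A v * branchGen z b A v) := by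
    intro A hA
    rw [(Finset.mem_filter.1 hA).2]; ring
  rw [Finset.sum_congr rfl t1, ← Finset.mul_sum]
  -- The prefactor n removes the case n = 0, where the bound 1 + 2n ≤ 3n used for the branch sums
  -- fails.
  rcases Nat.eq_zero_or_pos n with rfl | hn
  · simp
  refine (mul_le_mul_of_nonneg_left (sum_weight_branchGen_le h0 h1 hl0.le hb1.le hz0 (hK V) hn F v)
    (by positivity)).trans ?_
  rw [mul_assoc, ← Real.exp_add, hρ, ← Real.exp_nat_mul]
  refine mul_le_mul_of_nonneg_left (Real.exp_le_exp.2 ?_) (Nat.cast_nonneg n)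
  have hn0 : (0 : ℝ) ≤ n := Nat.cast_nonneg n
  -- Budget: τ = g/4, gain at least 2g, l ≤ g and zc ≤ g/4 leave the exponent at most -g/2 per edge.
  have : (g / 4 - α * Real.log b) + (l + z * c) ≤ -(g / 2) := by linarith
  have := mul_le_mul_of_nonneg_right this hn0
  linarith

end FiniteVolume

end BondPercolation

namespace BondPercolation

/-! ### Passage to locally finite graphs -/

noncomputable section InfiniteVolume

open scoped Classical
open MeasureTheory

variable {V : Type*} (G : SimpleGraph V) (v : V)

/-- The configurations agreeing with `A` on the edges of `D`. -/
def agreeOn (D A : Finset (Sym2 V)) : Set (Set (Sym2 V)) := {ω | ∀ e ∈ D, e ∈ ω ↔ e ∈ A}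

theorem measurableSet_agreeOn (D A : Finset (Sym2 V)) : MeasurableSet (agreeOn D A) := by
  have : agreeOn D A = ⋂ e ∈ D, {ω : Set (Sym2 V) | e ∈ ω ↔ e ∈ A} := by
    ext ω; simp [agreeOn]
  rw [this]
  refine Finset.measurableSet_biInter _ fun e _ => ?_
  by_cases he : e ∈ A
  · simpa [he] using measurableSet_setOfPred.2 (measurable_set_mem e)
  · simpa [he] using measurableSet_setOfPred.2 (measurable_set_notMem e)

theorem bernoulliLaw_agreeOn (p : unitInterval) {D A : Finset (Sym2 V)} (hAD : A ⊆ D)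
    (hD : (D : Set (Sym2 V)) ⊆ G.edgeSet) :
    bernoulliLaw G p (agreeOn D A) =
      ENNReal.ofReal ((p : ℝ) ^ A.card * (1 - p) ^ (D.card - A.card)) := by
  rw [bernoulliLaw, ProbabilityTheory.setBernoulli_apply']
  have h1 : (fun q : Sym2 V → Prop => {i | q i}) ⁻¹' agreeOn D A =
      Set.pi (D : Set (Sym2 V)) (fun e => {P : Prop | P ↔ e ∈ A}) := by
    ext q; simp [agreeOn, Set.mem_pi]
  rw [h1, Measure.infinitePi_pi _ (fun _ _ => MeasurableSet.of_discrete)]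
  have h2 : ∀ e ∈ D, (unitInterval.toNNReal p • Measure.dirac (e ∈ G.edgeSet) +
      unitInterval.toNNReal (unitInterval.symm p) • Measure.dirac False :
        Measure Prop) {P : Prop | P ↔ e ∈ A} =
      if e ∈ A then ENNReal.ofReal p else ENNReal.ofReal (1 - p) := by
    intro e he
    have heG : e ∈ G.edgeSet := hD he
    have c1 : ((unitInterval.toNNReal p : NNReal) : ℝ≥0∞) = ENNReal.ofReal p := by
      rw [ENNReal.ofReal, ENNReal.coe_inj]; ext; simp [p.2.1]
    have c2 : ((unitInterval.toNNReal (unitInterval.symm p) : NNReal) : ℝ≥0∞) =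
        ENNReal.ofReal (1 - p) := by
      rw [ENNReal.ofReal, ENNReal.coe_inj]; ext; simp [p.2.2]
    rw [Measure.add_apply, Measure.smul_apply, Measure.smul_apply, ENNReal.smul_def,
      ENNReal.smul_def, c1, c2, Measure.dirac_apply' _ MeasurableSet.of_discrete,
      Measure.dirac_apply' _ MeasurableSet.of_discrete]
    by_cases heA : e ∈ A <;> simp [heA, heG]
  rw [Finset.prod_congr rfl h2, Finset.prod_ite, Finset.prod_const, Finset.prod_const,
    Finset.filter_mem_eq_inter, Finset.inter_eq_right.2 hAD, Finset.filter_notMem_eq_sdiff,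
    Finset.card_sdiff_of_subset hAD, ENNReal.ofReal_mul (pow_nonneg p.2.1 _),
    ENNReal.ofReal_pow p.2.1, ENNReal.ofReal_pow (sub_nonneg.2 p.2.2)]

/-- The edges of `G` with an endpoint in the cluster of `v` in `A`. -/
def touchSet (A : Finset (Sym2 V)) : Set (Sym2 V) := {e | e ∈ G.edgeSet ∧ ∃ x ∈ e, Conn A v x}

/-- The edge sets of the finite clusters of `v`. -/
def finiteClusters : Set (Finset (Sym2 V)) :=
  {A | (touchSet G v A).Finite ∧ (A : Set (Sym2 V)) ⊆ touchSet G v A}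

theorem countable_reachable [G.LocallyFinite] : {x | G.Reachable v x}.Countable := by
  have hball : ∀ n : ℕ, {x | ∃ w : G.Walk v x, w.length = n}.Countable := by
    intro n
    induction n with
    | zero =>
      refine (Set.countable_singleton v).mono ?_
      rintro x ⟨w, hw⟩
      exact (SimpleGraph.Walk.eq_of_length_eq_zero hw).symm
    | succ n ih =>
      refine (ih.biUnion fun y _ => (G.neighborFinset y).countable_toSet).mono ?_
      rintro x ⟨w, hw⟩
      obtain ⟨y, w', h, rfl⟩ : ∃ (y : V) (w' : G.Walk v y) (h : G.Adj y x),
          w = w'.concat h := by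
        cases w with
        | nil => simp at hw
        | cons h q =>
          obtain ⟨y, w', h', e⟩ := SimpleGraph.Walk.exists_cons_eq_concat h q
          exact ⟨y, w', h', e⟩
      rw [SimpleGraph.Walk.length_concat] at hw
      exact Set.mem_biUnion (x := y) ⟨w', by omega⟩ (by simpa using h)
  refine (Set.countable_iUnion hball).mono ?_
  rintro x ⟨w⟩
  exact Set.mem_iUnion.2 ⟨w.length, w, rfl⟩

theorem reachable_of_conn {A : Finset (Sym2 V)} (hA : (A : Set (Sym2 V)) ⊆ G.edgeSet) {x : V}
    (h : Conn A v x) : G.Reachable v x :=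
  h.induct (P := fun x => G.Reachable v x) (SimpleGraph.Reachable.refl _)
    fun _ _ hxy _ hx => hx.trans (SimpleGraph.Adj.reachable (hA hxy))

/-- Countability allows the integral to be exchanged with the sum over possible finite clusters;
only the component of `v` matters, so `V` itself may be uncountable. -/
theorem countable_finiteClusters [G.LocallyFinite] : (finiteClusters G v).Countable := by
  set U : Set (Sym2 V) := (fun x : V × V => s(x.1, x.2)) ''
    ({x | G.Reachable v x} ×ˢ {x | G.Reachable v x}) with hU
  have hUc : U.Countable := ((countable_reachable G v).prod (countable_reachable G v)).image _
  have h1 : {A : Set (Sym2 V) | A.Finite ∧ A ⊆ U}.Countable := Set.countable_ofPred_finite_subset hUc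
  refine (h1.preimage Finset.coe_injective).mono ?_
  rintro A ⟨-, hA⟩
  refine ⟨A.finite_toSet, fun e he => ?_⟩
  have hAG : (A : Set (Sym2 V)) ⊆ G.edgeSet := fun e he => (hA he).1
  obtain ⟨heG, x, hx, hvx⟩ := hA he
  induction e using Sym2.inductionOn with
  | _ a b =>
    have ha : Conn A v a := hvx.of_mem he hx (by simp)
    have hb : Conn A v b := hvx.of_mem he hx (by simp)
    exact ⟨(a, b), ⟨reachable_of_conn G v hAG ha, reachable_of_conn G v hAG hb⟩, rfl⟩

/-- The finite set of edges touching a finite cluster. -/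
def touchFinset (A : finiteClusters G v) : Finset (Sym2 V) := A.2.1.toFinset

theorem mem_touchFinset {A : finiteClusters G v} {e : Sym2 V} :
    e ∈ touchFinset G v A ↔ e ∈ G.edgeSet ∧ ∃ x ∈ e, Conn A.1 v x := by
  rw [touchFinset, Set.Finite.mem_toFinset]; rfl

theorem subset_touchFinset (A : finiteClusters G v) : A.1 ⊆ touchFinset G v A := fun _ he =>
  A.2.1.mem_toFinset.2 (A.2.2 he)

theorem conn_iff_reachable {ω : Set (Sym2 V)} {A : Finset (Sym2 V)}
    (hA : ∀ e, e ∈ A ↔ e ∈ touchingEdges (cluster G ω v) ∧ e ∈ ω) (x : V) :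
    Conn A v x ↔ (openGraph G ω).Reachable v x := by
  constructor
  · intro h
    refine h.induct (P := fun x => (openGraph G ω).Reachable v x)
      (SimpleGraph.Reachable.refl _) ?_
    intro x y hxy _ hx
    obtain ⟨⟨hG, -⟩, hω⟩ := (hA _).1 hxy
    have hadj : G.Adj x y := hG
    refine hx.trans (SimpleGraph.Adj.reachable ?_)
    exact ⟨hadj, (SimpleGraph.fromEdgeSet_adj _).2 ⟨hω, hadj.ne⟩⟩
  · intro h
    rw [SimpleGraph.reachable_iff_reflTransGen] at h
    induction h with
    | refl => exact Conn.refl _ _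
    | @tail y z hy hyz ih =>
      refine ih.tail ((hA _).2 ⟨⟨hyz.1, y, ?_, by simp⟩,
        ((SimpleGraph.fromEdgeSet_adj _).1 hyz.2).1⟩)
      exact (SimpleGraph.reachable_iff_reflTransGen _ _).2 hy

theorem exists_finiteCluster {ω : Set (Sym2 V)} (hfin : (touchingEdges (cluster G ω v)).Finite) :
    ∃ A : finiteClusters G v, ω ∈ agreeOn (touchFinset G v A) A.1 ∧
      touchingEdges (cluster G ω v) = touchFinset G v A ∧
      ∀ e, e ∈ A.1 ↔ e ∈ touchingEdges (cluster G ω v) ∧ e ∈ ω := by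
  have hA : ∀ e, e ∈ hfin.toFinset.filter (· ∈ ω) ↔
      e ∈ touchingEdges (cluster G ω v) ∧ e ∈ ω := by simp
  have hconn := conn_iff_reachable G v hA
  set A := hfin.toFinset.filter (· ∈ ω) with hAdef
  have htouch : touchSet G v A = touchingEdges (cluster G ω v) := by
    ext e
    constructor
    · rintro ⟨he, x, hx, hvx⟩
      exact ⟨he, x, (hconn x).1 hvx, hx⟩
    · rintro ⟨he, x, hvx, hx⟩
      exact ⟨he, x, hx, (hconn x).2 hvx⟩
  have hmem : A ∈ finiteClusters G v :=
    ⟨htouch ▸ hfin, fun e he => htouch ▸ ((hA e).1 he).1⟩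
  refine ⟨⟨A, hmem⟩, fun e he => ?_, ?_, hA⟩
  · rw [hA]
    have : e ∈ touchSet G v A := hmem.1.mem_toFinset.1 he
    rw [htouch] at this
    exact ⟨fun h => ⟨this, h⟩, fun h => h.2⟩
  · rw [← htouch, touchFinset, Set.Finite.coe_toFinset]

theorem piv_subset_pivotalSet {ω : Set (Sym2 V)} {A : Finset (Sym2 V)}
    (hA : ∀ e, e ∈ A ↔ e ∈ touchingEdges (cluster G ω v) ∧ e ∈ ω) (W : Finset V) :
    piv (cluster G ω v) v (W : Set V) ⊆ pivotalSet A v W := by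
  have hconn := conn_iff_reachable G v hA
  have hmem : ∀ {x y : V}, (cluster G ω v).Adj x y → s(x, y) ∈ A := by
    intro x y h
    exact (hA _).2 ⟨⟨h.1.1, x, h.2, by simp⟩, ((SimpleGraph.fromEdgeSet_adj _).1 h.1.2).1⟩
  rintro e ⟨he, w, hw, hne⟩
  refine Finset.mem_coe.2 (Finset.mem_biUnion.2 ⟨w, hw, mem_pivotal.2 ⟨?_, fun hc => hne ?_⟩⟩)
  · induction e using Sym2.inductionOn with
    | _ x y => exact hmem he
  · refine hc.induct
      (P := fun x => (((cluster G ω v).deleteEdges {e}).spanningCoe).Reachable v x)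
      (SimpleGraph.Reachable.refl _) ?_
    intro x y hxy hvx hx
    refine hx.trans (SimpleGraph.Adj.reachable ?_)
    obtain ⟨hxe, hxA⟩ := Finset.mem_erase.1 hxy
    obtain ⟨⟨hG, -⟩, hω⟩ := (hA _).1 hxA
    have hadj : G.Adj x y := hG
    simp only [SimpleGraph.Subgraph.spanningCoe_adj, SimpleGraph.Subgraph.deleteEdges_adj,
      Set.mem_singleton_iff]
    refine ⟨⟨⟨hadj, (SimpleGraph.fromEdgeSet_adj _).2 ⟨hω, hadj.ne⟩⟩, ?_⟩, hxe⟩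
    exact (hconn x).1 (hvx.mono (Finset.erase_subset _ _))

/-- The value of the integrand, bounded in terms of the edge set of the cluster. -/
def clusterValue (α : ℝ) (k : ℕ) (A : finiteClusters G v) : ℝ≥0∞ :=
  if ∃ W ⊆ clusterVerts A.1 v, W.card ≤ k ∧
      α * (touchFinset G v A).card ≤ (pivotalSet A.1 v W).card then
    ENNReal.ofReal ((touchFinset G v A).card * (touchFinset G v A).card ^ k) else 0

theorem exists_br_eq {ω : Set (Sym2 V)} {k : ℕ} (h : br k (cluster G ω v) v < ⊤) :
    ∃ W : Finset V, (W : Set V) ⊆ (cluster G ω v).verts ∧ W.card ≤ k ∧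
      br k (cluster G ω v) v = (piv (cluster G ω v) v (W : Set V)).encard := by
  have hsub : br k (cluster G ω v) v =
      ⨆ W : {W : Finset V // (W : Set V) ⊆ (cluster G ω v).verts ∧ W.card ≤ k},
        (piv (cluster G ω v) v (W.1 : Set V)).encard := by
    rw [br, iSup_subtype]
  have : Nonempty {W : Finset V // (W : Set V) ⊆ (cluster G ω v).verts ∧ W.card ≤ k} :=
    ⟨⟨∅, by simp, by simp⟩⟩
  rw [hsub] at h ⊢
  obtain ⟨W, hW⟩ := ENat.exists_eq_iSup_of_lt_top h
  exact ⟨W.1, W.2.1, W.2.2, hW.symm⟩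

theorem indicator_le_tsum {α : ℝ} (hα : 0 < α) (k : ℕ) (ω : Set (Sym2 V)) :
    Set.indicator
      {ω | ENNReal.ofReal α * (numTouching G ω v : ℝ≥0∞) ≤ (br k (cluster G ω v) v : ℝ≥0∞) ∧
        (br k (cluster G ω v) v : ℝ≥0∞) < ∞}
      (fun ω => (br k (cluster G ω v) v : ℝ≥0∞) * (numTouching G ω v : ℝ≥0∞) ^ k) ω ≤
    ∑' A : finiteClusters G v,
      (agreeOn (touchFinset G v A) A.1).indicator (fun _ => clusterValue G v α k A) ω := by
  rw [Set.indicator_apply]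
  split_ifs with hω
  swap
  · exact zero_le
  obtain ⟨hle, hlt⟩ := hω
  have hbr : br k (cluster G ω v) v < ⊤ := by
    rw [lt_top_iff_ne_top] at hlt ⊢
    intro h
    rw [h] at hlt
    exact hlt rfl
  -- An infinite touching number would force α·∞ ≤ Br_k < ∞, so the event sees only finite clusters.
  have hfin : (touchingEdges (cluster G ω v)).Finite := by
    rw [← Set.encard_ne_top_iff]
    intro h
    rw [numTouching, h, ENat.toENNReal_top,
      ENNReal.mul_top (ENNReal.ofReal_pos.2 hα).ne'] at hle
    exact (hle.trans_lt hlt).ne rfl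
  obtain ⟨A, hωA, hT, hA⟩ := exists_finiteCluster G v hfin
  obtain ⟨W, hWv, hWk, hW⟩ := exists_br_eq G v hbr
  have hsub := piv_subset_pivotalSet G v hA W
  have hbr_le : br k (cluster G ω v) v ≤ ((pivotalSet A.1 v W).card : ℕ∞) := by
    rw [hW, ← Set.encard_coe_eq_coe_finsetCard]
    exact Set.encard_le_encard hsub
  have hnum : numTouching G ω v = ((touchFinset G v A).card : ℕ∞) := by
    rw [numTouching, hT, Set.encard_coe_eq_coe_finsetCard]
  have hbr_le' : (br k (cluster G ω v) v : ℝ≥0∞) ≤ ((pivotalSet A.1 v W).card : ℝ≥0∞) := by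
    have := ENat.toENNReal_le.2 hbr_le
    simpa using this
  have hnum' : (numTouching G ω v : ℝ≥0∞) = ((touchFinset G v A).card : ℝ≥0∞) := by
    rw [hnum]; simp
  have hpsub : pivotalSet A.1 v W ⊆ touchFinset G v A := fun e he => by
    obtain ⟨w, -, he⟩ := Finset.mem_biUnion.1 he
    exact subset_touchFinset G v A (mem_pivotal.1 he).1
  have hpcard := Finset.card_le_card hpsub
  refine le_trans ?_ (ENNReal.le_tsum A)
  rw [Set.indicator_of_mem hωA, clusterValue, if_pos]
  · rw [hnum', ENNReal.ofReal_mul (Nat.cast_nonneg _), ENNReal.ofReal_pow (Nat.cast_nonneg _),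
      ENNReal.ofReal_natCast]
    gcongr
    exact hbr_le'.trans (by exact_mod_cast hpcard)
  · refine ⟨W, fun x hx => mem_clusterVerts.2
      ((conn_iff_reachable G v hA x).2 (hWv hx)), hWk, ?_⟩
    have h1 := hle.trans hbr_le'
    rw [hnum', ← ENNReal.ofReal_natCast, ← ENNReal.ofReal_mul hα.le, ← ENNReal.ofReal_natCast,
      ENNReal.ofReal_le_ofReal_iff (Nat.cast_nonneg _)] at h1
    exact h1

theorem lintegral_indicator_le [G.LocallyFinite] {α : ℝ} (hα : 0 < α) (p : unitInterval) (k : ℕ) :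
    ∫⁻ ω, Set.indicator
      {ω | ENNReal.ofReal α * (numTouching G ω v : ℝ≥0∞) ≤ (br k (cluster G ω v) v : ℝ≥0∞) ∧
        (br k (cluster G ω v) v : ℝ≥0∞) < ∞}
      (fun ω => (br k (cluster G ω v) v : ℝ≥0∞) * (numTouching G ω v : ℝ≥0∞) ^ k) ω
      ∂(bernoulliLaw G p) ≤
    ∑' A : finiteClusters G v, clusterValue G v α k A *
      ENNReal.ofReal ((p : ℝ) ^ A.1.card * (1 - p) ^ ((touchFinset G v A).card - A.1.card)) := by
  have : Countable (finiteClusters G v) := (countable_finiteClusters G v).to_subtype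
  -- The integrand is dominated pointwise by a sum of measurable indicators, so its own
  -- measurability is not required.
  refine (lintegral_mono (indicator_le_tsum G v hα k)).trans ?_
  rw [lintegral_tsum fun A =>
    (measurable_const.indicator (measurableSet_agreeOn _ _)).aemeasurable]
  refine ENNReal.tsum_le_tsum fun A => ?_
  rw [lintegral_indicator_const (measurableSet_agreeOn _ _),
    bernoulliLaw_agreeOn G p (subset_touchFinset G v A)
      (fun e he => ((mem_touchFinset G v).1 he).1)]

theorem touch_eq_touchFinset {F : Finset (Sym2 V)} (hF : (F : Set (Sym2 V)) ⊆ G.edgeSet)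
    {A : finiteClusters G v} (hAF : touchFinset G v A ⊆ F) :
    touch F A.1 v = touchFinset G v A := by
  ext e
  rw [mem_touch]
  refine ⟨fun h => (mem_touchFinset G v).2 ⟨hF h.1, h.2⟩, fun h => ⟨hAF h, ?_⟩⟩
  exact ((mem_touchFinset G v).1 h).2

theorem branchGen_nonneg {z b : ℝ} (hz : 0 ≤ z) (hb : 0 ≤ b) (A : Finset (Sym2 V)) :
    0 ≤ branchGen z b A v :=
  Finset.sum_nonneg fun _ _ => mul_nonneg (pow_nonneg hz _) (pow_nonneg hb _)

/-- A witness `W` with |W| ≤ k and many separating edges gives z^k ≤ z^|W| ≤ e^(-α n log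
b)·`branchGen`. From t ≤ τz the k-th term is at most n(τn)^k/k! times this, and the series sums to
at most n·e^(τn). -/
theorem tsum_clusterValue_le {α b τ z t : ℝ} (hb : 1 < b) (hτ : 0 < τ) (hz0 : 0 < z)
    (hz1 : z ≤ 1) (ht0 : 0 ≤ t) (ht : t ≤ τ * z) (A : finiteClusters G v) :
    ∑' k : ℕ, ENNReal.ofReal (t ^ (k + 1) / ((k + 1)! : ℝ)) * clusterValue G v α (k + 1) A ≤
      ENNReal.ofReal ((touchFinset G v A).card *
          Real.exp ((τ - α * Real.log b) * (touchFinset G v A).card) * branchGen z b A.1 v) := by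
  set n := (touchFinset G v A).card with hn
  set S := Real.exp (-(α * Real.log b * n)) * branchGen z b A.1 v with hS
  have hb0 : 0 < b := by linarith
  have hS0 : 0 ≤ S := mul_nonneg (Real.exp_pos _).le (branchGen_nonneg v hz0.le hb0.le _)
  have hterm : ∀ k : ℕ, ENNReal.ofReal (t ^ (k + 1) / ((k + 1)! : ℝ)) *
      clusterValue G v α (k + 1) A ≤
        ENNReal.ofReal (n * S * ((τ * n) ^ (k + 1) / ((k + 1)! : ℝ))) := by
    intro k
    rw [clusterValue]
    split_ifs with h
    · obtain ⟨W, hWv, hWk, hW⟩ := h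
      rw [← ENNReal.ofReal_mul (by positivity)]
      refine ENNReal.ofReal_le_ofReal ?_
      have h1 : z ^ W.card ≤ S := by
        have e1 : z ^ W.card * b ^ (pivotalSet A.1 v W).card ≤ branchGen z b A.1 v :=
          Finset.single_le_sum (f := fun W => z ^ W.card * b ^ (pivotalSet A.1 v W).card)
            (fun _ _ => by positivity) (Finset.mem_powerset.2 hWv)
        have e2 : Real.exp (α * Real.log b * n) ≤ b ^ (pivotalSet A.1 v W).card := by
          rw [← Real.exp_log (pow_pos hb0 _), Real.log_pow]
          refine Real.exp_le_exp.2 ?_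
          have := mul_le_mul_of_nonneg_right hW (Real.log_pos hb).le
          linarith
        have e3 : Real.exp (-(α * Real.log b * n)) * Real.exp (α * Real.log b * n) = 1 := by
          rw [← Real.exp_add, neg_add_cancel, Real.exp_zero]
        calc z ^ W.card = Real.exp (-(α * Real.log b * n)) *
              (z ^ W.card * Real.exp (α * Real.log b * n)) := by
                rw [mul_left_comm, e3, mul_one]
          _ ≤ Real.exp (-(α * Real.log b * n)) *
              (z ^ W.card * b ^ (pivotalSet A.1 v W).card) := by gcongr
          _ ≤ S := mul_le_mul_of_nonneg_left e1 (Real.exp_pos _).le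
      have h2 : t ^ (k + 1) ≤ τ ^ (k + 1) * S := by
        refine (pow_le_pow_left₀ ht0 ht _).trans ?_
        rw [mul_pow]
        exact mul_le_mul_of_nonneg_left ((pow_le_pow_of_le_one hz0.le hz1 hWk).trans h1)
          (by positivity)
      have h3 : 0 ≤ (n : ℝ) * n ^ (k + 1) / ((k + 1)! : ℝ) := by positivity
      calc t ^ (k + 1) / ((k + 1)! : ℝ) * (n * n ^ (k + 1)) =
            t ^ (k + 1) * ((n : ℝ) * n ^ (k + 1) / ((k + 1)! : ℝ)) := by ring
        _ ≤ τ ^ (k + 1) * S * ((n : ℝ) * n ^ (k + 1) / ((k + 1)! : ℝ)) :=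
            mul_le_mul_of_nonneg_right h2 h3
        _ = _ := by rw [mul_pow]; ring
    · rw [mul_zero]; exact zero_le
  refine (ENNReal.tsum_le_tsum hterm).trans (ENNReal.tsum_le_of_sum_range_le fun N => ?_)
  rw [← ENNReal.ofReal_sum_of_nonneg fun _ _ => by positivity, ← Finset.mul_sum]
  refine ENNReal.ofReal_le_ofReal ?_
  have h4 : ∑ k ∈ Finset.range N, (τ * n) ^ (k + 1) / ((k + 1)! : ℝ) ≤ Real.exp (τ * n) := by
    have := sum_pow_div_factorial_le_exp (y := τ * n) (by positivity) (N + 1)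
    rw [Finset.sum_range_succ'] at this
    simp only [pow_zero, Nat.factorial_zero, Nat.cast_one, div_one] at this
    linarith
  refine (mul_le_mul_of_nonneg_left h4 (by positivity)).trans_eq ?_
  rw [hS, sub_mul, sub_eq_add_neg, Real.exp_add]
  ring

/-- Any finite family of clusters lives in the finite set of edges touching one of them. There its
touching sets and weights agree with those in `G`, so the uniform finite-volume bound applies to
every partial sum. -/
theorem tsum_weight_le {b τ z C p α : ℝ} (h0 : 0 ≤ p) (h1 : p ≤ 1) (hb : 0 ≤ b) (hz : 0 ≤ z)
    (hC : ∀ (F : Finset (Sym2 V)), ∑ A ∈ clusters F v, weight p F A v * ((touch F A v).card *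
          Real.exp ((τ - α * Real.log b) * (touch F A v).card) * branchGen z b A v) ≤ C) :
    ∑' A : finiteClusters G v, ENNReal.ofReal
      (p ^ A.1.card * (1 - p) ^ ((touchFinset G v A).card - A.1.card) *
        ((touchFinset G v A).card * Real.exp ((τ - α * Real.log b) * (touchFinset G v A).card) *
          branchGen z b A.1 v)) ≤ ENNReal.ofReal C := by
  have hq : 0 ≤ 1 - p := sub_nonneg.2 h1
  rw [ENNReal.tsum_eq_iSup_sum]
  refine iSup_le fun s => ?_
  have hnn : ∀ (n m k : ℕ) (A : Finset (Sym2 V)), 0 ≤ p ^ n * (1 - p) ^ m *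
      (k * Real.exp ((τ - α * Real.log b) * k) * branchGen z b A v) := fun n m k A =>
    mul_nonneg (mul_nonneg (pow_nonneg h0 _) (pow_nonneg hq _)) (mul_nonneg (by positivity)
      (branchGen_nonneg v hz hb A))
  rw [← ENNReal.ofReal_sum_of_nonneg fun _ _ => hnn _ _ _ _]
  refine ENNReal.ofReal_le_ofReal (le_trans ?_ (hC (s.biUnion (touchFinset G v))))
  have hF : ((s.biUnion (touchFinset G v) : Finset (Sym2 V)) : Set (Sym2 V)) ⊆ G.edgeSet := by
    intro e he
    obtain ⟨A, -, he⟩ := Finset.mem_biUnion.1 (Finset.mem_coe.1 he)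
    exact ((mem_touchFinset G v).1 he).1
  have htouch : ∀ A ∈ s, touch (s.biUnion (touchFinset G v)) A.1 v = touchFinset G v A :=
    fun A hA => touch_eq_touchFinset G v hF (Finset.subset_biUnion_of_mem _ hA)
  refine sum_le_sum_of_injOn_map (fun A : finiteClusters G v => A.1) ?_
    Subtype.val_injective.injOn ?_ fun A _ => hnn _ _ _ _
  · intro A hA
    rw [mem_clusters, htouch A hA]
    exact subset_touchFinset G v A
  · intro A hA
    rw [weight, htouch A hA]

end InfiniteVolume

end BondPercolation

/-! ### Assembly -/

open BondPercolation in
theorem proposition2p3 (α : ℝ) (hα : 0 < α) (p : unitInterval) (hp0 : 0 < p) (hp1 : p < 1) :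
    ∃ t₀ : ℝ, 0 < t₀ ∧
      ∀ (V : Type*) (G : SimpleGraph V) [G.LocallyFinite] (v : V) (t : ℝ), 0 ≤ t → t < t₀ →
        ∑' k : ℕ, ENNReal.ofReal (t ^ (k + 1) / ((k + 1)! : ℝ)) *
          ∫⁻ ω, Set.indicator
            {ω | ENNReal.ofReal α * (BondPercolation.numTouching G ω v : ℝ≥0∞) ≤
                (BondPercolation.br (k + 1) (BondPercolation.cluster G ω v) v : ℝ≥0∞) ∧
              (BondPercolation.br (k + 1) (BondPercolation.cluster G ω v) v : ℝ≥0∞) < ∞}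
            (fun ω => (BondPercolation.br (k + 1) (BondPercolation.cluster G ω v) v : ℝ≥0∞) *
              (BondPercolation.numTouching G ω v : ℝ≥0∞) ^ (k + 1)) ω
            ∂(BondPercolation.bernoulliLaw G p) < ∞ := by
  have h0 : (0 : ℝ) < p := hp0
  have h1 : (p : ℝ) < 1 := hp1
  obtain ⟨b, τ, z, C, hb, hτ, hz0, hz1, hC⟩ := exists_sum_weight_branchGen_le hα h0 h1
  refine ⟨τ * z, mul_pos hτ hz0, fun V G _ v t ht0 ht => ?_⟩
  refine lt_of_le_of_lt ?_ (ENNReal.ofReal_lt_top (r := C))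
  refine (ENNReal.tsum_le_tsum fun k => mul_le_mul_right
    (lintegral_indicator_le G v hα p (k + 1)) _).trans ?_
  simp_rw [← ENNReal.tsum_mul_left]
  -- Summing over k first, for each fixed cluster, turns the series into an exponential before the
  -- clusters are averaged.
  rw [ENNReal.tsum_comm]
  refine le_trans (ENNReal.tsum_le_tsum fun A => ?_)
    (tsum_weight_le G v h0.le h1.le (by linarith) hz0.le (hC V · v))
  rw [tsum_congr fun k => (mul_assoc _ _ _).symm, ENNReal.tsum_mul_right]
  have hq : (0 : ℝ) ≤ 1 - p := sub_nonneg.2 h1.le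
  have hw : 0 ≤ (p : ℝ) ^ A.1.card * (1 - p) ^ ((touchFinset G v A).card - A.1.card) := by
    positivity
  rw [mul_comm, ENNReal.ofReal_mul hw]
  exact mul_le_mul_right (tsum_clusterValue_le G v hb hτ hz0 hz1 ht0 ht.le A) _
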